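/- Let $M$ be a connected, second countable, Hausdorff smooth manifold of dimension $n\ge 2$, let $\tau\colon TM\to M$ be its tangent bundle and $\mathring TM$ the set of nonzero tangent vectors. For $v,w\in T_pM$ let $\mathbf i(v,w)\in T_vTM$ be the initial velocity of $t\mapsto v+tw$, let $\mathbf j=\tau_*\colon T_vTM\to T_{\tau(v)}M$, and let $C(v)=\mathbf i(v,v)$ be the Liouville vector field. A spray is a vector field $S$ on $TM$ which is of class $C^1$, is smooth on $\mathring TM$, and satisfies $\mathbf jS(v)=v$ for all $v$ and $[C,S]=S$. Its Ehresmann connection $\mathcal H$ is determined by $\mathcal H(\widehat X)=\frac12\left(X^{\mathsf c}+[X^{\mathsf v},S]\right)$ for vector fields $X$ on $M$, where $\widehat X=X\circ\tau$, $X^{\mathsf v}=\mathbf i\widehat X$ is the vertical lift and $X^{\mathsf c}$ the complete lift of $X$. Put $\mathcal V=\mathbf i^{-1}\circ(1-\mathcal H\circ\mathbf j)$. For smooth vector fields $\widetilde X,\widetilde Y,\widetilde Z$ along $\tau\restriction\mathring TM$ and a vector field $\xi$ on $\mathring TM$ let $$\nabla_\xi\widetilde Y=\mathbf j[\mathbf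 i\mathcal V\xi,\mathcal H\widetilde Y]+\mathcal V[\mathcal H\mathbf j\xi,\mathbf i\widetilde Y].$$ The Berwald curvature of $S$ is the tensor $\mathbf B(\widetilde X,\widetilde Y)\widetilde Z=R^\nabla(\mathbf i\widetilde X,\mathcal H\widetilde Y)\widetilde Z$ on $\mathring TM$, where $R^\nabla$ is the curvature of $\nabla$. $S$ is called Berwald if $\mathbf B=0$, and weakly Berwald if $\operatorname{tr}\bigl(\widetilde X\mapsto\mathbf B(\widetilde X,\widetilde Y)\widetilde Z\bigr)=0$ for all $\widetilde Y,\widetilde Z$. A second-order vector field over $M$ is a smooth vector field $\xi$ on $TM$ with $\mathbf j\xi(v)=v$ for all $v$. For a 1-form $\alpha$ on $M$, $\alpha^{\mathsf v}=\tau^*\alpha$ is its vertical lift. Let $S$ and $\overline S=S-2PC$ be two sprays over $M$, where $P\colon TM\to\mathbb R$ is continuous on $TM$ and smooth on $\mathring TM$, and consider the condition (*) there is a smooth 1-form $\alpha$ on $M$ such that $P=i_\xi\alpha^{\mathsf v}$ for every second-order vector field $\xi$ over $M$. Then: 1. $S$ and $\overline S$ have the same Berwald curvature if and only if (*) holds.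 2. If $S$ is a Berwald spray, then $\overline S$ is a Berwald spray if and only if (*) holds. 3. If $S$ is a weakly Berwald spray, then $\overline S$ is a weakly Berwald spray if and only if (*) holds. -/

import Mathlib

open Set Bundle Manifold
open scoped ContDiff Topology

namespace SprayGeometry

noncomputable section

variable {E : Type*} [NormedAddCommGroup E] [NormedSpace ℝ E] [FiniteDimensional ℝ E]
  {M : Type*} [TopologicalSpace M] [ChartedSpace E M] [IsManifold 𝓘(ℝ, E) ∞ M]

variable (E M) in
/-- The tangent manifold `TM` of a manifold `M` modelled on `E`; a point is `v = ⟨p, v.2⟩` with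
`p = v.proj` and `v.2 ∈ T_p M`. -/
abbrev TM : Type _ := TangentBundle 𝓘(ℝ, E) M

/-- The tangent space `T_v TM`. -/
abbrev TTM (v : TM E M) : Type _ := TangentSpace 𝓘(ℝ, E).tangent v

variable (E M) in
/-- The slit tangent manifold: the set of nonzero tangent vectors. -/
def slit : Set (TM E M) := {v | v.2 ≠ 0}

/-- Vector fields along the projection `τ : TM → M`, i.e. (not necessarily smooth) sections of the
pull-back bundle `TM ×_M TM → TM`, the fibre over `v` being `T_{τ(v)} M`. -/
abbrev FieldAlong (E : Type*) [NormedAddCommGroup E] [NormedSpace ℝ E]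
    (M : Type*) [TopologicalSpace M] [ChartedSpace E M] [IsManifold 𝓘(ℝ, E) ∞ M] : Type _ :=
  ∀ v : TM E M, TangentSpace 𝓘(ℝ, E) v.proj

/-- (Not necessarily smooth) vector fields on the manifold `TM`. -/
abbrev FieldTM (E : Type*) [NormedAddCommGroup E] [NormedSpace ℝ E]
    (M : Type*) [TopologicalSpace M] [ChartedSpace E M] [IsManifold 𝓘(ℝ, E) ∞ M] : Type _ :=
  ∀ v : TM E M, TTM v

/-- `X` is smooth over the slit tangent manifold, i.e. (its restriction is) a section of the
pull-back bundle over the slit tangent manifold. -/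
def FieldAlong.SmoothOnSlit (X : FieldAlong E M) : Prop :=
  ContMDiffOn 𝓘(ℝ, E).tangent 𝓘(ℝ, E).tangent ∞
    (fun v : TM E M => (⟨v.proj, X v⟩ : TM E M)) (slit E M)

/-- The basic vector field along `τ` given by a vector field on `M`. -/
def basic (X : ∀ p : M, TangentSpace 𝓘(ℝ, E) p) : FieldAlong E M := fun v => X v.proj

/-- The canonical injection `𝐢(v, w) = ċ(0)`, where `c(t) = v + t w`. -/
def vert (v : TM E M) (w : TangentSpace 𝓘(ℝ, E) v.proj) : TTM v :=
  (mfderiv 𝓘(ℝ, ℝ) 𝓘(ℝ, E).tangent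
    (fun t : ℝ => (⟨v.proj, v.2 + t • w⟩ : TM E M)) 0 (1 : ℝ) : E × E)

/-- The canonical surjection `𝐣 : T_v TM → T_{τ(v)} M`, the derivative of `τ`. -/
def proj (v : TM E M) (ξ : TTM v) : TangentSpace 𝓘(ℝ, E) v.proj :=
  mfderiv 𝓘(ℝ, E).tangent 𝓘(ℝ, E) (fun u : TM E M => u.proj) v ξ

/-- The Liouville vector field `C = 𝐢 δ`, where `δ(v) = (v, v)`. -/
def liouville : FieldTM E M := fun v => vert v v.2

/-- Lie bracket of vector fields on `TM`. -/
def bracket (ξ η : FieldTM E M) : FieldTM E M :=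
  fun v => VectorField.mlieBracket 𝓘(ℝ, E).tangent ξ η v

/-- `S` is a spray over `M`. -/
structure IsSpray (S : FieldTM E M) : Prop where
  smoothOn : ContMDiffOn 𝓘(ℝ, E).tangent 𝓘(ℝ, E).tangent.tangent ∞
    (fun v => (⟨v, S v⟩ : TangentBundle 𝓘(ℝ, E).tangent (TM E M))) (slit E M)
  contMDiff_one : ContMDiff 𝓘(ℝ, E).tangent 𝓘(ℝ, E).tangent.tangent 1
    (fun v => (⟨v, S v⟩ : TangentBundle 𝓘(ℝ, E).tangent (TM E M)))
  proj_eq : ∀ v, proj v (S v) = v.2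
  homogeneous : ∀ v, bracket liouville S v = S v

/-- `ξ` is a second-order vector field over `M`: smooth on all of `TM`, with `𝐣 ξ = δ`. -/
structure IsSecondOrder (ξ : FieldTM E M) : Prop where
  smooth : ContMDiff 𝓘(ℝ, E).tangent 𝓘(ℝ, E).tangent.tangent ∞
    (fun v => (⟨v, ξ v⟩ : TangentBundle 𝓘(ℝ, E).tangent (TM E M)))
  proj_eq : ∀ v, proj v (ξ v) = v.2

/-- The complete lift `Xᶜ` of a vector field `X` on `M`, i.e. `κ ∘ TX` with `κ` the canonical
involution of `TTM`. If `p = τ(v)`, then the tangent vector `TX(v.2)` to `TM` at `X(p)` is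
`(v.2, z)` in the coordinates that the chart at `p` induces on `TM`; these coordinates are those by
which both `T_{X(p)} TM` and `T_v TM` are identified with `E × E`, and `Xᶜ(v) = (X(p), z)`. -/
def completeLift (X : ∀ p : M, TangentSpace 𝓘(ℝ, E) p) : FieldTM E M := fun v =>
  ((X v.proj,
    (mfderiv 𝓘(ℝ, E) 𝓘(ℝ, E).tangent (fun p => (⟨p, X p⟩ : TM E M)) v.proj v.2 : E × E).2) : E × E)

/-- The Ehresmann connection associated to `S`: the map `(v, w) ↦ 𝓗(v, w) ∈ T_v TM` with
`𝓗(X̂) = (Xᶜ + [Xᵛ, S]) / 2`, where `X̂ = basic X` and `Xᵛ = 𝐢 X̂`. The right side at `v` depends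
on `X` only through `X(τ(v))`; as `X` we take the field that has constant components in the
trivialization of the tangent bundle at `τ(v)`. -/
def connection (S : FieldTM E M) (v : TM E M) (w : TangentSpace 𝓘(ℝ, E) v.proj) : TTM v :=
  let X : ∀ p : M, TangentSpace 𝓘(ℝ, E) p := FiberBundle.extend E w
  (1 / 2 : ℝ) • (completeLift X v + bracket (fun u => vert u (basic X u)) S v)

section Berwald

/-! In this section `H` stands for an Ehresmann connection `(v, w) ↦ 𝓗(v, w) ∈ T_v TM`. -/

variable (H : ∀ v : TM E M, TangentSpace 𝓘(ℝ, E) v.proj → TTM v)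

/-- The vertical map `𝓥 = 𝐢⁻¹ ∘ (1 - 𝐡)`, with `𝐡 = 𝓗 ∘ 𝐣`. -/
def verticalMap (v : TM E M) (ξ : TTM v) : TangentSpace 𝓘(ℝ, E) v.proj :=
  Function.invFun (vert v) (ξ - H v (proj v ξ))

/-- The vertical derivative `∇ᵛ_X Y = 𝐣[𝐢X, η]`, where `η = 𝓗Y`, so that `𝐣η = Y`. -/
def vDeriv (X Y : FieldAlong E M) : FieldAlong E M :=
  fun v => proj v (bracket (fun u => vert u (X u)) (fun u => H u (Y u)) v)

/-- The horizontal derivative `∇ʰ_X Y = 𝓥[𝓗X, 𝐢Y]`. -/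
def hDeriv (X Y : FieldAlong E M) : FieldAlong E M :=
  fun v => verticalMap H v (bracket (fun u => H u (X u)) (fun u => vert u (Y u)) v)

/-- The Berwald derivative `∇_ξ Y = ∇ᵛ_{𝓥ξ} Y + ∇ʰ_{𝐣ξ} Y`. -/
def berwaldDeriv (ξ : FieldTM E M) (Y : FieldAlong E M) : FieldAlong E M :=
  fun v => vDeriv H (fun u => verticalMap H u (ξ u)) Y v + hDeriv H (fun u => proj u (ξ u)) Y v

/-- The curvature `R^∇(ξ, η) Z` of the Berwald derivative. -/
def berwaldDerivCurvature (ξ η : FieldTM E M) (Z : FieldAlong E M) : FieldAlong E M :=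
  fun v => berwaldDeriv H ξ (berwaldDeriv H η Z) v - berwaldDeriv H η (berwaldDeriv H ξ Z) v
    - berwaldDeriv H (bracket ξ η) Z v

/-- The Berwald curvature `𝐁(X, Y) Z = R^∇(𝐢X, 𝓗Y) Z` of an Ehresmann connection. -/
def berwaldCurvature (X Y Z : FieldAlong E M) : FieldAlong E M :=
  berwaldDerivCurvature H (fun v => vert v (X v)) (fun v => H v (Y v)) Z

/-- The trace `(tr 𝐁)(Y, Z) = tr (X ↦ 𝐁(X, Y) Z)` at `v`, computed in a basis of `T_{τ(v)} M`;
a basis vector `b` is extended to the basic field of the vector field on `M` that has value `b` at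
`τ(v)` and constant components in the trivialization of the tangent bundle there. -/
def berwaldTrace (Y Z : FieldAlong E M) (v : TM E M) : ℝ :=
  let b : Module.Basis _ ℝ (TangentSpace 𝓘(ℝ, E) v.proj) := Module.finBasis ℝ E
  ∑ i, b.coord i (berwaldCurvature H (basic (FiberBundle.extend E (b i))) Y Z v)

end Berwald

/-- `S` is a Berwald spray: the Berwald curvature of its Ehresmann connection vanishes. -/
def IsBerwald (S : FieldTM E M) : Prop :=
  ∀ X Y Z : FieldAlong E M, X.SmoothOnSlit → Y.SmoothOnSlit → Z.SmoothOnSlit →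
    ∀ v ∈ slit E M, berwaldCurvature (connection S) X Y Z v = 0

/-- `S` is weakly Berwald: the Berwald curvature of its Ehresmann connection is traceless. -/
def IsWeaklyBerwald (S : FieldTM E M) : Prop :=
  ∀ Y Z : FieldAlong E M, Y.SmoothOnSlit → Z.SmoothOnSlit →
    ∀ v ∈ slit E M, berwaldTrace (connection S) Y Z v = 0

/-- `S` and `S'` have the same Berwald curvature. -/
def SameBerwaldCurvature (S S' : FieldTM E M) : Prop :=
  ∀ X Y Z : FieldAlong E M, X.SmoothOnSlit → Y.SmoothOnSlit → Z.SmoothOnSlit →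
    ∀ v ∈ slit E M,
      berwaldCurvature (connection S') X Y Z v = berwaldCurvature (connection S) X Y Z v

/-- `S' = S - 2 P C` with `S`, `S'` sprays and `P` continuous on `TM`, smooth on the slit tangent
manifold. -/
structure IsProjectiveChange (S S' : FieldTM E M) (P : TM E M → ℝ) : Prop where
  isSpray : IsSpray S
  isSpray' : IsSpray S'
  continuous : Continuous P
  smoothOn : ContMDiffOn 𝓘(ℝ, E).tangent 𝓘(ℝ, ℝ) ∞ P (slit E M)
  eq : ∀ v, S' v = S v - (2 * P v) • liouville v

/-- Smooth 1-forms on `M`. -/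
def IsOneForm (α : ∀ p : M, TangentSpace 𝓘(ℝ, E) p →L[ℝ] ℝ) : Prop :=
  ContMDiff 𝓘(ℝ, E) (𝓘(ℝ, E).prod 𝓘(ℝ, E →L[ℝ] ℝ)) ∞
    (fun p => TotalSpace.mk' (E →L[ℝ] ℝ)
      (E := fun p : M => TangentSpace 𝓘(ℝ, E) p →L[ℝ] Trivial M ℝ p) p (α p))

/-- The vertical lift of a 1-form on `M`: its pull-back to `TM` along `τ`. -/
def verticalLift (α : ∀ p : M, TangentSpace 𝓘(ℝ, E) p →L[ℝ] ℝ) (v : TM E M) (ξ : TTM v) : ℝ :=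
  α v.proj (proj v ξ)

/-- `P = i_ξ αᵛ` for some 1-form `α` on `M`, with `ξ` any second-order vector field over `M`. -/
def IsLiftOfOneForm (P : TM E M → ℝ) : Prop :=
  ∃ α : ∀ p : M, TangentSpace 𝓘(ℝ, E) p →L[ℝ] ℝ, IsOneForm α ∧
    ∀ ξ : FieldTM E M, IsSecondOrder ξ → ∀ v, P v = verticalLift α v (ξ v)

end

end SprayGeometry

set_option linter.unusedSectionVars false

open Set Bundle Manifold Filter

/-! In a chart of `TM` induced from `M` a spray is `(y, s(x, y))`, and its connection lifts `w` to
`(w, -N w)` with `N = -½ ∂_y s` (`dtchart_connection`). The Berwald derivative becomes `∇_ξ Y =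
DY(ξ) + DN(0, Y)(𝐣ξ)`. In its curvature between a vertical and a horizontal field every term cancels
except the second fibre derivative of `N`. So `𝐁` at `v` is `-½` times the third derivative of `s`
along the tangent space containing `v` (`IsSpray.berwaldCurvature_eq`), and the problem becomes
calculus on a single vector space `T_p M`.

Passing from `S` to `S - 2PC` replaces `s` by `s - 2P y`, so `𝐁` changes by `D³(P y)`
(`IsProjectiveChange.berwaldCurvature_eq`). Homogeneity of both sprays forces Euler's relation
`DP(y) y = P(y)` for `y ≠ 0`. Differentiating it twice gives `D³P(y, ·, ·) = -D²P`, and then the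
trace of `D³(P y)` is `(n + 1) D²P` (`sum_coord_fderiv_fderiv_fderiv_smul_self`). Hence equality of
the curvatures, or just of their traces, forces `D²P = 0` on nonzero vectors.

Since `n ≥ 2`, the punctured tangent space is connected, so `DP` is constant there; Euler's relation
and continuity at zero make `P` linear on each `T_p M` (`eq_fderiv_of_fderiv_fderiv_eq_zero`). The
resulting 1-form is smooth because its components are values of `P` at nonzero vectors
(`IsProjectiveChange.isOneForm`).

Conversely, (*) makes `P` fibrewise linear, provided that some second-order vector field exists to
test it on; a partition of unity supplies one (`exists_isSecondOrder`). Then `D²P = 0`, and each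
term of `D³(P y)` contains a second or third derivative of `P`. -/

namespace SprayGeometry

noncomputable section

variable {E : Type*} [NormedAddCommGroup E] [NormedSpace ℝ E] [FiniteDimensional ℝ E]
  {M : Type*} [TopologicalSpace M] [ChartedSpace E M] [IsManifold 𝓘(ℝ, E) ∞ M]

/-! ### Natural charts of `TM`; lifts, projection and Lie bracket in coordinates -/

/-- The chart of `TM` induced by the preferred chart of `M` at `p`. -/
def tchart (p : M) : PartialEquiv (TM E M) (E × E) :=
  extChartAt 𝓘(ℝ, E).tangent (⟨p, 0⟩ : TM E M)

/-- The coordinates of tangent vectors at `q` in the preferred chart at `p`. -/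
def fibreCoord (p q : M) : TangentSpace 𝓘(ℝ, E) q →L[ℝ] E :=
  mfderiv 𝓘(ℝ, E) 𝓘(ℝ, E) (extChartAt 𝓘(ℝ, E) p) q

/-- The coordinates of tangent vectors at `u` in the chart `tchart p` of `TM`. -/
def dtchart (p : M) (u : TM E M) : TTM u →L[ℝ] E × E :=
  mfderiv 𝓘(ℝ, E).tangent 𝓘(ℝ, E × E) (tchart p) u

/-- Principal part of a vector field on `TM` in the chart `tchart p`. -/
def repTM (p : M) (ξ : FieldTM E M) (z : E × E) : E × E :=
  dtchart p ((tchart p).symm z) (ξ ((tchart p).symm z))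

/-- Principal part of a vector field along `τ` in the chart `tchart p`. -/
def repAlong (p : M) (X : FieldAlong E M) (z : E × E) : E :=
  fibreCoord p ((tchart p).symm z).proj (X ((tchart p).symm z))

lemma isOpen_tchart_target (p : M) : IsOpen (tchart (E := E) p).target :=
  isOpen_extChartAt_target _

lemma isOpen_tchart_source (p : M) : IsOpen (tchart (E := E) p).source :=
  isOpen_extChartAt_source _

lemma mem_tchart_source {p : M} {u : TM E M} :
    u ∈ (tchart p).source ↔ u.proj ∈ (chartAt E p).source := by
  rw [tchart, extChartAt_source, TangentBundle.mem_chart_source_iff]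

/-- The trivialization of `TM` at `p` acts on each fibre as the derivative of the chart at `p`, so
these are the natural coordinates `(x, dx)`. -/
lemma tchart_apply {p : M} {u : TM E M} (hu : u.proj ∈ (chartAt E p).source) :
    tchart p u = (extChartAt 𝓘(ℝ, E) p u.proj, fibreCoord p u.proj u.2) := by
  unfold tchart fibreCoord
  rw [← TangentBundle.continuousLinearMapAt_trivializationAt hu]
  rw [FiberBundle.extChartAt]
  refine Prod.ext rfl ?_
  have hb : u.proj ∈ (trivializationAt E (TangentSpace 𝓘(ℝ, E)) p).baseSet := hu
  exact ((trivializationAt E (TangentSpace 𝓘(ℝ, E)) p).continuousLinearMapAt_apply_of_mem ℝ hb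
    u.2).symm

lemma tchart_symm_proj {p : M} {z : E × E} (hz : z ∈ (tchart p : PartialEquiv (TM E M) _).target) :
    ((tchart p : PartialEquiv (TM E M) _).symm z).proj = (extChartAt 𝓘(ℝ, E) p).symm z.1 := by
  have h1 := (tchart p).right_inv hz
  have h2 := (tchart p).map_target hz
  rw [mem_tchart_source] at h2
  rw [tchart_apply h2] at h1
  rw [← congrArg Prod.fst h1]
  exact ((extChartAt 𝓘(ℝ, E) p).left_inv (by simpa using h2)).symm

lemma fibreCoord_self (p : M) : fibreCoord (E := E) p p = ContinuousLinearMap.id ℝ _ :=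
  mfderiv_extChartAt_self

lemma dtchart_self (v : TM E M) : dtchart v.proj v = ContinuousLinearMap.id ℝ _ :=
  mfderiv_extChartAt_self (I := 𝓘(ℝ, E).tangent) (x := v)

lemma fibreCoord_isInvertible {p q : M} (hq : q ∈ (chartAt E p).source) :
    (fibreCoord (E := E) p q).IsInvertible :=
  isInvertible_mfderiv_extChartAt (I := 𝓘(ℝ, E)) (by simpa using hq)

lemma dtchart_isInvertible {p : M} {u : TM E M} (hu : u.proj ∈ (chartAt E p).source) :
    (dtchart p u).IsInvertible :=
  isInvertible_mfderiv_extChartAt (I := 𝓘(ℝ, E).tangent) (mem_tchart_source.2 hu)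

lemma hasMFDerivAt_tchart {p : M} {u : TM E M} (hu : u.proj ∈ (chartAt E p).source) :
    HasMFDerivAt 𝓘(ℝ, E).tangent 𝓘(ℝ, E × E) (tchart p) u (dtchart p u) :=
  (mdifferentiableAt_extChartAt (extChartAt_source (I := 𝓘(ℝ, E).tangent) (⟨p, 0⟩ : TM E M) ▸
    mem_tchart_source.2 hu)).hasMFDerivAt

lemma hasMFDerivAt_extChartAt' {p q : M} (hq : q ∈ (chartAt E p).source) :
    HasMFDerivAt 𝓘(ℝ, E) 𝓘(ℝ, E) (extChartAt 𝓘(ℝ, E) p) q (fibreCoord p q) :=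
  (mdifferentiableAt_extChartAt hq).hasMFDerivAt

lemma contMDiffOn_tchart_symm (p : M) :
    ContMDiffOn 𝓘(ℝ, E × E) 𝓘(ℝ, E).tangent ∞ (tchart p).symm (tchart (E := E) p).target :=
  contMDiffOn_extChartAt_symm _

lemma contMDiffOn_tchart (p : M) :
    ContMDiffOn 𝓘(ℝ, E).tangent 𝓘(ℝ, E × E) ∞ (tchart p) (tchart (E := E) p).source := by
  rw [tchart, extChartAt_source]
  exact contMDiffOn_extChartAt


lemma symm_proj_mem {p : M} {z : E × E}
    (hz : z ∈ (tchart p : PartialEquiv (TM E M) _).target) :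
    ((tchart p : PartialEquiv (TM E M) _).symm z).proj ∈ (chartAt E p).source :=
  mem_tchart_source.1 ((tchart p).map_target hz)

lemma fibreCoord_symm {p : M} {z : E × E}
    (hz : z ∈ (tchart p : PartialEquiv (TM E M) _).target) :
    fibreCoord p ((tchart p : PartialEquiv (TM E M) _).symm z).proj
      ((tchart p : PartialEquiv (TM E M) _).symm z).2 = z.2 := by
  have h1 := (tchart p).right_inv hz
  rw [tchart_apply (symm_proj_mem hz)] at h1
  exact congrArg Prod.snd h1

/-- `𝐣` in coordinates. -/
lemma fibreCoord_proj {p : M} {u : TM E M} (hu : u.proj ∈ (chartAt E p).source) (ξ : TTM u) :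
    fibreCoord p u.proj (proj u ξ) = (dtchart p u ξ).1 := by
  have h1 : HasMFDerivAt 𝓘(ℝ, E).tangent 𝓘(ℝ, E) (fun u : TM E M => u.proj) u
      (mfderiv 𝓘(ℝ, E).tangent 𝓘(ℝ, E) (fun u : TM E M => u.proj) u) :=
    ((contMDiff_proj (n := 1) (TangentSpace 𝓘(ℝ, E) : M → Type _)).mdifferentiable
      one_ne_zero u).hasMFDerivAt
  have h2 := (hasMFDerivAt_extChartAt' hu).comp u h1
  have h3 : HasMFDerivAt 𝓘(ℝ, E).tangent 𝓘(ℝ, E) (fun u => (tchart p u).1) u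
      ((ContinuousLinearMap.fst ℝ E E).comp (dtchart p u)) :=
    (ContinuousLinearMap.fst ℝ E E).hasMFDerivAt.comp u (hasMFDerivAt_tchart hu)
  have h4 : (fun u => (tchart p u).1) =ᶠ[𝓝 u]
      (extChartAt 𝓘(ℝ, E) p) ∘ (fun u : TM E M => u.proj) := by
    filter_upwards [(isOpen_tchart_source p).mem_nhds (mem_tchart_source.2 hu)] with w hw
    rw [tchart_apply (mem_tchart_source.1 hw)]; rfl
  have h5 := hasMFDerivAt_unique (h2.congr_of_eventuallyEq h4) h3
  exact DFunLike.congr_fun h5 ξ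

/-- The map `𝐢` is defined as the velocity of a curve; this is the chain rule that lets that
velocity be computed in a chart. -/
lemma dtchart_curve {p : M} {γ : ℝ → TM E M} {u : TM E M} (h : γ 0 = u)
    (hu : u.proj ∈ (chartAt E p).source) (hγ : MDifferentiableAt 𝓘(ℝ, ℝ) 𝓘(ℝ, E).tangent γ 0)
    {c : E × E} (hc : HasDerivAt (fun t => tchart p (γ t)) c 0) :
    dtchart p u (mfderiv 𝓘(ℝ, ℝ) 𝓘(ℝ, E).tangent γ 0 (1 : ℝ) : E × E) = c := by
  subst h
  have h1 := (hasMFDerivAt_tchart hu).comp 0 hγ.hasMFDerivAt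
  have h2 := hc.hasFDerivAt.hasMFDerivAt
  have h3 := DFunLike.congr_fun (hasMFDerivAt_unique h1 h2) (1 : ℝ)
  exact h3.trans (one_smul ℝ c)

lemma symm_tchart {p : M} {u : TM E M} (hu : u.proj ∈ (chartAt E p).source) :
    (tchart p).symm (tchart p u) = u := (tchart p).left_inv (mem_tchart_source.2 hu)

/-- `𝐢` in coordinates. -/
lemma dtchart_vert {p : M} {u : TM E M} (hu : u.proj ∈ (chartAt E p).source)
    (w : TangentSpace 𝓘(ℝ, E) u.proj) :
    dtchart p u (vert u w) = (0, fibreCoord p u.proj w) := by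
  have key : ∀ t : ℝ, tchart p (⟨u.proj, u.2 + t • w⟩ : TM E M) =
      (extChartAt 𝓘(ℝ, E) p u.proj, fibreCoord p u.proj u.2 + t • fibreCoord p u.proj w) := by
    intro t
    rw [tchart_apply (u := ⟨u.proj, u.2 + t • w⟩) hu]; simp
  have hd : HasDerivAt (fun t : ℝ => (extChartAt 𝓘(ℝ, E) p u.proj,
      fibreCoord p u.proj u.2 + t • fibreCoord p u.proj w)) (0, fibreCoord p u.proj w) 0 := by
    refine (hasDerivAt_const _ _).prodMk ?_
    simpa using ((hasDerivAt_id (0 : ℝ)).smul_const (fibreCoord p u.proj w)).const_add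
      (fibreCoord p u.proj u.2)
  refine dtchart_curve (γ := fun t : ℝ => (⟨u.proj, u.2 + t • w⟩ : TM E M)) ?_ hu ?_ ?_
  · simp
  · have : (fun t : ℝ => (⟨u.proj, u.2 + t • w⟩ : TM E M)) =
        (tchart p).symm ∘ fun t : ℝ => (extChartAt 𝓘(ℝ, E) p u.proj,
          fibreCoord p u.proj u.2 + t • fibreCoord p u.proj w) := by
      funext t
      rw [Function.comp_apply, ← key, symm_tchart (u := ⟨u.proj, u.2 + t • w⟩) hu]
    rw [this]
    refine MDifferentiableAt.comp _ (I' := 𝓘(ℝ, E × E)) ?_ hd.differentiableAt.mdifferentiableAt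
    refine ((contMDiffOn_tchart_symm p).contMDiffAt
      ((isOpen_tchart_target p).mem_nhds ?_)).mdifferentiableAt (by simp)
    rw [← key]
    exact (tchart p).map_source (mem_tchart_source.2 hu)
  · simpa only [key] using hd

lemma tchart_symm_contMDiffAt {p : M} {z : E × E}
    (hz : z ∈ (tchart p : PartialEquiv (TM E M) _).target) :
    ContMDiffAt 𝓘(ℝ, E × E) 𝓘(ℝ, E).tangent ∞ (tchart p : PartialEquiv (TM E M) _).symm z :=
  (contMDiffOn_tchart_symm p).contMDiffAt ((isOpen_tchart_target p).mem_nhds hz)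

lemma tchart_contMDiffAt {p : M} {u : TM E M} (hu : u.proj ∈ (chartAt E p).source) :
    ContMDiffAt 𝓘(ℝ, E).tangent 𝓘(ℝ, E × E) ∞ (tchart p) u :=
  (contMDiffOn_tchart p).contMDiffAt ((isOpen_tchart_source p).mem_nhds (mem_tchart_source.2 hu))

/-- Over the chart domain the trivialization of `T(TM)` is the derivative of `tchart p`, so a field
is as smooth as its principal part. -/
lemma contMDiffAt_iff_repTM {n : ℕ∞} {p : M} {ξ : FieldTM E M} {u : TM E M}
    (hu : u.proj ∈ (chartAt E p).source) :
    ContMDiffAt 𝓘(ℝ, E).tangent 𝓘(ℝ, E).tangent.tangent n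
      (fun v => (⟨v, ξ v⟩ : TangentBundle 𝓘(ℝ, E).tangent (TM E M))) u ↔
    ContDiffAt ℝ n (repTM p ξ) (tchart p u) := by
  let e := trivializationAt (E × E) (TangentSpace 𝓘(ℝ, E).tangent) (⟨p, 0⟩ : TM E M)
  have hb : ∀ w : TM E M, w.proj ∈ (chartAt E p).source → w ∈ e.baseSet := fun w hw => by
    have := mem_tchart_source.2 hw
    rwa [tchart, extChartAt_source] at this
  rw [Bundle.Trivialization.contMDiffAt_section_iff e (hb u hu)]
  have h1 : ∀ w : TM E M, w.proj ∈ (chartAt E p).source → (e ⟨w, ξ w⟩).2 = dtchart p w (ξ w) := by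
    intro w hw
    unfold dtchart tchart
    rw [← TangentBundle.continuousLinearMapAt_trivializationAt (hb w hw)]
    exact (e.continuousLinearMapAt_apply_of_mem ℝ (hb w hw) (ξ w)).symm
  have h2 : (fun w => (e ⟨w, ξ w⟩).2) =ᶠ[𝓝 u] fun w => dtchart p w (ξ w) := by
    filter_upwards [(isOpen_tchart_source p).mem_nhds (mem_tchart_source.2 hu)] with w hw
    exact h1 w (mem_tchart_source.1 hw)
  have hz : tchart p u ∈ (tchart p : PartialEquiv (TM E M) _).target :=
    (tchart p).map_source (mem_tchart_source.2 hu)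
  rw [h2.contMDiffAt_iff, ← contMDiffAt_iff_contDiffAt]
  constructor
  · intro h
    refine ContMDiffAt.comp (I' := 𝓘(ℝ, E).tangent) (tchart p u) (g := fun w => dtchart p w (ξ w))
      (f := (tchart p).symm) ?_ ((tchart_symm_contMDiffAt hz).of_le (by exact_mod_cast le_top))
    rwa [symm_tchart hu]
  · intro h
    refine (h.comp u ((tchart_contMDiffAt hu).of_le
      (by exact_mod_cast le_top))).congr_of_eventuallyEq ?_
    filter_upwards [(isOpen_tchart_source p).mem_nhds (mem_tchart_source.2 hu)] with w hw
    simp only [Function.comp_apply, repTM]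
    rw [symm_tchart (mem_tchart_source.1 hw)]

lemma contDiffAt_repAlong {n : ℕ∞} {p : M} {X : FieldAlong E M} {u : TM E M}
    (hu : u.proj ∈ (chartAt E p).source)
    (hX : ContMDiffAt 𝓘(ℝ, E).tangent 𝓘(ℝ, E).tangent n
      (fun v : TM E M => (⟨v.proj, X v⟩ : TM E M)) u) :
    ContDiffAt ℝ n (repAlong p X) (tchart p u) := by
  have hz : tchart p u ∈ (tchart p : PartialEquiv (TM E M) _).target :=
    (tchart p).map_source (mem_tchart_source.2 hu)
  rw [← contMDiffAt_iff_contDiffAt]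
  have h1 := (tchart_contMDiffAt (p := p) (u := ⟨u.proj, X u⟩) hu).of_le
    (m := n) (by exact_mod_cast le_top)
  have h2 := (h1.comp u hX)
  have h3 : ContMDiffAt 𝓘(ℝ, E × E) 𝓘(ℝ, E × E) n (fun z => tchart p (⟨((tchart p).symm z).proj,
      X ((tchart p).symm z)⟩ : TM E M)) (tchart p u) := by
    refine ContMDiffAt.comp (I' := 𝓘(ℝ, E).tangent) (tchart p u)
      (g := fun w : TM E M => tchart p (⟨w.proj, X w⟩ : TM E M))
      (f := (tchart p).symm) ?_ ((tchart_symm_contMDiffAt hz).of_le (by exact_mod_cast le_top))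
    rwa [symm_tchart hu]
  refine ((contDiff_snd.contMDiff.contMDiffAt).comp _ h3).congr_of_eventuallyEq ?_
  filter_upwards [(isOpen_tchart_target p).mem_nhds hz] with z hz
  rw [Function.comp_apply, tchart_apply (u := ⟨((tchart p).symm z).proj, X ((tchart p).symm z)⟩)
    (symm_proj_mem hz)]
  rfl

/-- The derivative of the chart is inverse to that of the inverse chart. Principal parts are thereby
pullbacks, for which naturality of the Lie bracket is available. -/
lemma repTM_eq_mpullback {p : M} (ξ : FieldTM E M) {z : E × E}
    (hz : z ∈ (tchart p : PartialEquiv (TM E M) _).target) :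
    repTM p ξ z = VectorField.mpullback 𝓘(ℝ, E × E) 𝓘(ℝ, E).tangent
      (tchart p : PartialEquiv (TM E M) _).symm ξ z := by
  have h1 := mfderiv_extChartAt_comp_mfderivWithin_extChartAt_symm (I := 𝓘(ℝ, E).tangent)
    (x := (⟨p, 0⟩ : TM E M)) hz
  have h2 := mfderivWithin_extChartAt_symm_comp_mfderiv_extChartAt (I := 𝓘(ℝ, E).tangent)
    (x := (⟨p, 0⟩ : TM E M)) hz
  have hr : range 𝓘(ℝ, E).tangent = univ := by simp
  rw [hr, mfderivWithin_univ] at h1 h2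
  rw [VectorField.mpullback_apply]
  have h3 := ContinuousLinearMap.inverse_eq h2 h1
  exact (DFunLike.congr_fun h3 _).symm

/-- The Lie bracket is natural under pullback by the inverse chart, and on a vector space the
manifold bracket is the ordinary one. -/
lemma repTM_bracket {p : M} {ξ η : FieldTM E M} {z : E × E}
    (hz : z ∈ (tchart p : PartialEquiv (TM E M) _).target)
    (hξ : ContDiffAt ℝ 1 (repTM p ξ) z) (hη : ContDiffAt ℝ 1 (repTM p η) z) :
    repTM p (bracket ξ η) z = VectorField.lieBracket ℝ (repTM p ξ) (repTM p η) z := by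
  have aux : ∀ ξ : FieldTM E M, ContDiffAt ℝ 1 (repTM p ξ) z →
      MDifferentiableAt 𝓘(ℝ, E).tangent 𝓘(ℝ, E).tangent.tangent
      (fun v => (⟨v, ξ v⟩ : TangentBundle 𝓘(ℝ, E).tangent (TM E M)))
        ((tchart p : PartialEquiv (TM E M) _).symm z) := by
    intro ξ hξ
    rw [← (tchart p : PartialEquiv (TM E M) _).right_inv hz] at hξ
    exact ((contMDiffAt_iff_repTM (n := 1) (symm_proj_mem hz)).2 hξ).mdifferentiableAt one_ne_zero
  have : IsManifold 𝓘(ℝ, E).tangent (minSmoothness ℝ 2) (TM E M) :=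
    IsManifold.of_le (n := ∞) (by simpa using! ENat.LEInfty.out)
  have h := VectorField.mpullback_mlieBracket (I := 𝓘(ℝ, E × E)) (n := ∞) (aux ξ hξ) (aux η hη)
    (tchart_symm_contMDiffAt hz) (by simpa using! ENat.LEInfty.out)
  rw [repTM_eq_mpullback _ hz]
  refine h.trans ?_
  have h' : ∀ V W : (∀ x : E × E, TangentSpace 𝓘(ℝ, E × E) x),
      VectorField.mlieBracket 𝓘(ℝ, E × E) V W z =
        VectorField.lieBracket ℝ (E := E × E) V W z := fun V W => by
    rw [← VectorField.mlieBracketWithin_univ, VectorField.mlieBracketWithin_eq_lieBracketWithin]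
    exact congrFun VectorField.lieBracketWithin_univ z
  refine (h' _ _).trans ?_
  have ev : ∀ ξ : FieldTM E M, VectorField.mpullback 𝓘(ℝ, E × E) 𝓘(ℝ, E).tangent
      (tchart p : PartialEquiv (TM E M) _).symm ξ =ᶠ[𝓝 z] repTM p ξ := fun ξ => by
    filter_upwards [(isOpen_tchart_target p).mem_nhds hz] with w hw
    exact (repTM_eq_mpullback ξ hw).symm
  exact (ev ξ).lieBracket_vectorField_eq (ev η)

lemma repTM_vert {p : M} {z : E × E} (hz : z ∈ (tchart p : PartialEquiv (TM E M) _).target)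
    (X : FieldAlong E M) : repTM p (fun u => vert u (X u)) z = (0, repAlong p X z) :=
  dtchart_vert (symm_proj_mem hz) _

lemma repAlong_proj {p : M} {z : E × E} (hz : z ∈ (tchart p : PartialEquiv (TM E M) _).target)
    (ξ : FieldTM E M) : repAlong p (fun u => proj u (ξ u)) z = (repTM p ξ z).1 :=
  fibreCoord_proj (symm_proj_mem hz) _

lemma repTM_fst_of_proj_eq {p : M} {z : E × E}
    (hz : z ∈ (tchart p : PartialEquiv (TM E M) _).target)
    {ξ : FieldTM E M} (hξ : ∀ v, proj v (ξ v) = v.2) : (repTM p ξ z).1 = z.2 := by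
  rw [← repAlong_proj hz, ← fibreCoord_symm hz]
  simp only [repAlong, hξ]

/-! ### Change of charts and the complete lift -/

/-- The change of coordinates between the preferred charts of `M` at `q` and at `p`. -/
def transition (q p : M) : E → E := extChartAt 𝓘(ℝ, E) p ∘ (extChartAt 𝓘(ℝ, E) q).symm

lemma contDiffAt_transition {p q r : M} (hp : r ∈ (chartAt E p).source)
    (hq : r ∈ (chartAt E q).source) :
    ContDiffAt ℝ ∞ (transition (E := E) q p) (extChartAt 𝓘(ℝ, E) q r) := by
  rw [← contMDiffAt_iff_contDiffAt]
  have hq' : extChartAt 𝓘(ℝ, E) q r ∈ (extChartAt 𝓘(ℝ, E) q).target :=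
    (extChartAt 𝓘(ℝ, E) q).map_source (by simpa using hq)
  refine ContMDiffAt.comp (I' := 𝓘(ℝ, E)) _ ?_
    ((contMDiffOn_extChartAt_symm q).contMDiffAt ((isOpen_extChartAt_target q).mem_nhds hq'))
  rw [(extChartAt 𝓘(ℝ, E) q).left_inv (by simpa using hq)]
  exact contMDiffAt_extChartAt' hp

lemma fibreCoord_transition {p q r : M} (hp : r ∈ (chartAt E p).source)
    (hq : r ∈ (chartAt E q).source) (w : TangentSpace 𝓘(ℝ, E) r) :
    fibreCoord p r w =
      fderiv ℝ (transition q p) (extChartAt 𝓘(ℝ, E) q r) (fibreCoord q r w) := by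
  have h1 := ((contDiffAt_transition hp hq).differentiableAt (by simp)).hasFDerivAt.hasMFDerivAt.comp
    r (hasMFDerivAt_extChartAt' hq)
  have h2 : (extChartAt 𝓘(ℝ, E) p) =ᶠ[𝓝 r] transition q p ∘ extChartAt 𝓘(ℝ, E) q := by
    filter_upwards [(chartAt E q).open_source.mem_nhds hq] with s hs
    simp only [transition, Function.comp_apply]
    rw [(extChartAt 𝓘(ℝ, E) q).left_inv (by simpa using hs)]
  exact DFunLike.congr_fun
    (hasMFDerivAt_unique (hasMFDerivAt_extChartAt' hp) (h1.congr_of_eventuallyEq h2)) w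

/-- The transformation law of `T_u TM`, from the preferred chart at `q = τ(u)` to the chart
at `p`. -/
lemma dtchart_transition {p : M} {u : TM E M} (hu : u.proj ∈ (chartAt E p).source) (a b : E) :
    dtchart p u ((a, b) : E × E) = (fibreCoord p u.proj a,
      fderiv ℝ (fderiv ℝ (transition u.proj p)) (extChartAt 𝓘(ℝ, E) u.proj u.proj) a u.2 +
        fibreCoord p u.proj b) := by
  set q := u.proj with hq
  have hqq : u.proj ∈ (chartAt E q).source := mem_chart_source E _
  have hfc : ∀ w : E, fibreCoord (E := E) q q w = w := fun w => by
    rw [fibreCoord_self]; rfl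
  have htq : tchart q u = (extChartAt 𝓘(ℝ, E) q q, u.2) := by
    rw [tchart_apply hqq]
    exact Prod.ext rfl (hfc u.2)
  -- Natural coordinates change by `(φ, Dφ · y)`; differentiating the second component produces the
  -- term with `D²φ`.
  let Ψ : E × E → E × E := fun z => (transition q p z.1, fderiv ℝ (transition q p) z.1 z.2)
  have hsm := contDiffAt_transition hu hqq
  have h1 : HasFDerivAt (transition q p) (fderiv ℝ (transition q p) (extChartAt 𝓘(ℝ, E) q q))
      (tchart q u).1 := by
    rw [htq]
    exact (hsm.differentiableAt (by simp)).hasFDerivAt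
  have h2 : HasFDerivAt (fderiv ℝ (transition q p))
      (fderiv ℝ (fderiv ℝ (transition q p)) (extChartAt 𝓘(ℝ, E) q q)) (tchart q u).1 := by
    rw [htq]
    exact ((hsm.fderiv_right (m := ∞) (by simp)).differentiableAt (by simp)).hasFDerivAt
  obtain ⟨L, hL, h3⟩ : ∃ L : E × E →L[ℝ] E × E, L (a, b) = (fibreCoord p q a,
      fderiv ℝ (fderiv ℝ (transition q p)) (extChartAt 𝓘(ℝ, E) q q) a u.2 + fibreCoord p q b) ∧
      HasFDerivAt Ψ L (tchart q u) := by
    refine ⟨_, ?_, (h1.comp (tchart q u) hasFDerivAt_fst).prodMk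
      ((h2.comp (tchart q u) hasFDerivAt_fst).clm_apply hasFDerivAt_snd)⟩
    have hft : ∀ w : E, fibreCoord p q w =
        fderiv ℝ (transition q p) (extChartAt 𝓘(ℝ, E) q q) w := fun w =>
      (fibreCoord_transition hu hqq w).trans (congrArg _ (hfc w))
    refine Prod.ext (hft a).symm ?_
    refine Eq.trans ?_ (congrArg (HAdd.hAdd _) (hft b).symm)
    rw [htq]
    exact add_comm _ _
  have h4 := (HasFDerivAt.hasMFDerivAt h3).comp u (hasMFDerivAt_tchart hqq)
  have h5 : tchart p =ᶠ[𝓝 u] Ψ ∘ tchart q := by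
    filter_upwards [(isOpen_tchart_source p).mem_nhds (mem_tchart_source.2 hu),
      (isOpen_tchart_source q).mem_nhds (mem_tchart_source.2 hqq)] with w hw hw'
    rw [mem_tchart_source] at hw hw'
    rw [Function.comp_apply, tchart_apply hw, tchart_apply hw', fibreCoord_transition hw hw']
    refine Prod.ext ?_ rfl
    simp only [Ψ, transition, Function.comp_apply]
    rw [(extChartAt 𝓘(ℝ, E) q).left_inv (by simpa using hw')]
  have h6 := DFunLike.congr_fun (hasMFDerivAt_unique (hasMFDerivAt_tchart hu)
    (h4.congr_of_eventuallyEq h5)) ((a, b) : E × E)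
  refine h6.trans ?_
  have h7 : dtchart q u ((a, b) : E × E) = (a, b) := by
    rw [hq, dtchart_self]; rfl
  exact (congrArg L h7).trans hL

/-- Principal part of a vector field on `M` in the preferred chart at `p`. -/
def repBase (p : M) (X : ∀ q : M, TangentSpace 𝓘(ℝ, E) q) (x : E) : E :=
  fibreCoord p ((extChartAt 𝓘(ℝ, E) p).symm x) (X ((extChartAt 𝓘(ℝ, E) p).symm x))

lemma repAlong_basic {p : M} {z : E × E} (hz : z ∈ (tchart p : PartialEquiv (TM E M) _).target)
    (X : ∀ q : M, TangentSpace 𝓘(ℝ, E) q) : repAlong p (basic X) z = repBase p X z.1 := by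
  simp only [repAlong, repBase, basic]
  rw [tchart_symm_proj hz]

lemma tchart_section_eventuallyEq {p q : M} (hq : q ∈ (chartAt E p).source)
    (X : ∀ q : M, TangentSpace 𝓘(ℝ, E) q) :
    (fun r => tchart p (⟨r, X r⟩ : TM E M)) =ᶠ[𝓝 q]
      fun r => (extChartAt 𝓘(ℝ, E) p r, repBase p X (extChartAt 𝓘(ℝ, E) p r)) := by
  filter_upwards [(chartAt E p).open_source.mem_nhds hq] with r hr
  rw [tchart_apply (u := ⟨r, X r⟩) hr]
  simp only [repBase]
  rw [(extChartAt 𝓘(ℝ, E) p).left_inv (by simpa using hr)]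

lemma contDiffAt_repBase {n : ℕ∞} {p q : M} (hq : q ∈ (chartAt E p).source)
    {X : ∀ q : M, TangentSpace 𝓘(ℝ, E) q}
    (hX : ContMDiffAt 𝓘(ℝ, E) 𝓘(ℝ, E).tangent n (fun r => (⟨r, X r⟩ : TM E M)) q) :
    ContDiffAt ℝ n (repBase p X) (extChartAt 𝓘(ℝ, E) p q) := by
  rw [← contMDiffAt_iff_contDiffAt]
  have hz : extChartAt 𝓘(ℝ, E) p q ∈ (extChartAt 𝓘(ℝ, E) p).target :=
    (extChartAt 𝓘(ℝ, E) p).map_source (by simpa using hq)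
  have h1 := ((tchart_contMDiffAt (p := p) (u := ⟨q, X q⟩) hq).of_le
    (m := n) (by exact_mod_cast le_top)).comp q hX
  have h3 : ContMDiffAt 𝓘(ℝ, E) 𝓘(ℝ, E × E) n (fun x => tchart p
      (⟨(extChartAt 𝓘(ℝ, E) p).symm x, X ((extChartAt 𝓘(ℝ, E) p).symm x)⟩ : TM E M))
      (extChartAt 𝓘(ℝ, E) p q) := by
    refine ContMDiffAt.comp (I' := 𝓘(ℝ, E)) (extChartAt 𝓘(ℝ, E) p q)
      (g := fun r => tchart p (⟨r, X r⟩ : TM E M))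
      (f := (extChartAt 𝓘(ℝ, E) p).symm) ?_ (((contMDiffOn_extChartAt_symm (n := ∞) p).contMDiffAt
        ((isOpen_extChartAt_target p).mem_nhds hz)).of_le (by exact_mod_cast le_top))
    rwa [(extChartAt 𝓘(ℝ, E) p).left_inv (by simpa using hq)]
  refine ((contDiff_snd.contMDiff.contMDiffAt).comp _ h3).congr_of_eventuallyEq ?_
  filter_upwards [(isOpen_extChartAt_target p).mem_nhds hz] with x hx
  have hx' : (extChartAt 𝓘(ℝ, E) p).symm x ∈ (chartAt E p).source := by
    simpa using (extChartAt 𝓘(ℝ, E) p).map_target hx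
  rw [Function.comp_apply, tchart_apply (u := ⟨(extChartAt 𝓘(ℝ, E) p).symm x,
    X ((extChartAt 𝓘(ℝ, E) p).symm x)⟩) hx']
  rfl

lemma dtchart_mfderiv_section {p q : M} (hq : q ∈ (chartAt E p).source)
    {X : ∀ q : M, TangentSpace 𝓘(ℝ, E) q}
    (hX : ContMDiffAt 𝓘(ℝ, E) 𝓘(ℝ, E).tangent 1 (fun r => (⟨r, X r⟩ : TM E M)) q)
    (a : TangentSpace 𝓘(ℝ, E) q) :
    dtchart p ⟨q, X q⟩ (mfderiv 𝓘(ℝ, E) 𝓘(ℝ, E).tangent (fun r => (⟨r, X r⟩ : TM E M)) q a) =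
      (fibreCoord p q a, fderiv ℝ (repBase p X) (extChartAt 𝓘(ℝ, E) p q) (fibreCoord p q a)) := by
  have h1 := (hasMFDerivAt_tchart (p := p) (u := ⟨q, X q⟩) hq).comp q
    (hX.mdifferentiableAt one_ne_zero).hasMFDerivAt
  have h2 := ((contDiffAt_repBase (n := 1) hq hX).differentiableAt one_ne_zero).hasFDerivAt
  have h3 := ((HasFDerivAt.prodMk (hasFDerivAt_id _) h2).hasMFDerivAt).comp q
    (hasMFDerivAt_extChartAt' hq)
  exact DFunLike.congr_fun (hasMFDerivAt_unique h1
    (h3.congr_of_eventuallyEq (tchart_section_eventuallyEq hq X))) a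

/-- The complete lift in coordinates. -/
lemma dtchart_completeLift {p : M} {u : TM E M} (hu : u.proj ∈ (chartAt E p).source)
    {X : ∀ q : M, TangentSpace 𝓘(ℝ, E) q}
    (hX : ContMDiffAt 𝓘(ℝ, E) 𝓘(ℝ, E).tangent 1 (fun r => (⟨r, X r⟩ : TM E M)) u.proj) :
    dtchart p u (completeLift X u) = (fibreCoord p u.proj (X u.proj),
      fderiv ℝ (repBase p X) (tchart p u).1 (tchart p u).2) := by
  have hqq : u.proj ∈ (chartAt E u.proj).source := mem_chart_source E _
  set z : E × E := mfderiv 𝓘(ℝ, E) 𝓘(ℝ, E).tangent (fun r => (⟨r, X r⟩ : TM E M)) u.proj u.2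
    with hz
  have h1 : z.1 = u.2 := by
    have := congrArg Prod.fst (dtchart_mfderiv_section hqq hX u.2)
    rw [fibreCoord_self] at this
    rw [show dtchart u.proj ⟨u.proj, X u.proj⟩ = ContinuousLinearMap.id ℝ _ from
      dtchart_self ⟨u.proj, X u.proj⟩] at this
    exact this
  have h2 := congrArg Prod.snd (dtchart_mfderiv_section hu hX u.2)
  have h3 := congrArg Prod.snd
    (dtchart_transition (p := p) (u := ⟨u.proj, X u.proj⟩) hu z.1 z.2)
  have h4 := dtchart_transition hu (X u.proj) z.2
  -- `completeLift` takes a component computed at `X(p)` and reads it at `u`. Going to the chart at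
  -- `p` adds `D²φ(u, X)` at the first point and `D²φ(X, u)` at the second; they agree by symmetry,
  -- which is the canonical involution in coordinates.
  have hs : IsSymmSndFDerivAt ℝ (transition (E := E) u.proj p)
      (extChartAt 𝓘(ℝ, E) u.proj u.proj) :=
    (contDiffAt_transition hu hqq).isSymmSndFDerivAt (by simpa using! ENat.LEInfty.out)
  refine h4.trans ?_
  rw [tchart_apply hu, hs.eq (X u.proj) u.2]
  refine Prod.ext rfl ?_
  have h5 := h3.symm.trans h2
  rw [h1] at h5
  exact h5

/-! ### The connection and the vertical map in coordinates -/

/-- The connection of `S` in coordinates. -/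
lemma dtchart_connection {S : FieldTM E M} {p : M} {u : TM E M}
    (hu : u.proj ∈ (chartAt E p).source) (hS : ∀ v, proj v (S v) = v.2)
    (hS1 : ContDiffAt ℝ 1 (repTM p S) (tchart p u)) (w : TangentSpace 𝓘(ℝ, E) u.proj) :
    dtchart p u (connection S u w) = (fibreCoord p u.proj w,
      (1 / 2 : ℝ) • (fderiv ℝ (repTM p S) (tchart p u) (0, fibreCoord p u.proj w)).2) := by
  set X : ∀ q : M, TangentSpace 𝓘(ℝ, E) q := FiberBundle.extend E w with hX
  have hXs : ContMDiffAt 𝓘(ℝ, E) 𝓘(ℝ, E).tangent 1 (fun r => (⟨r, X r⟩ : TM E M)) u.proj :=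
    FiberBundle.contMDiffAt_extend 𝓘(ℝ, E) E w
  have hXw : X u.proj = w := FiberBundle.extend_apply_self E w
  have hz : tchart p u ∈ (tchart p : PartialEquiv (TM E M) _).target :=
    (tchart p).map_source (mem_tchart_source.2 hu)
  have hev : repTM p (fun u => vert u (basic X u)) =ᶠ[𝓝 (tchart p u)]
      fun z => (0, repBase p X z.1) := by
    filter_upwards [(isOpen_tchart_target p).mem_nhds hz] with z hz
    rw [repTM_vert hz, repAlong_basic hz]
  have hXd : ContDiffAt ℝ 1 (repBase p X) (tchart p u).1 := by
    rw [tchart_apply hu]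
    exact contDiffAt_repBase (n := 1) hu hXs
  have hVd : ContDiffAt ℝ 1 (fun z : E × E => ((0 : E), repBase p X z.1)) (tchart p u) :=
    contDiffAt_const.prodMk (hXd.comp _ contDiffAt_fst)
  have h1 := repTM_bracket hz (hVd.congr_of_eventuallyEq hev) hS1
  rw [hev.lieBracket_vectorField_eq EventuallyEq.rfl] at h1
  have h2 : repTM p (bracket (fun u => vert u (basic X u)) S) (tchart p u) =
      dtchart p u (bracket (fun u => vert u (basic X u)) S u) := by
    simp only [repTM]
    rw [symm_tchart hu]
  rw [h2] at h1
  have h3 := dtchart_completeLift hu hXs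
  have hSfst : (fun z => (repTM p S z).1) =ᶠ[𝓝 (tchart p u)] fun z => z.2 := by
    filter_upwards [(isOpen_tchart_target p).mem_nhds hz] with z hz
    exact repTM_fst_of_proj_eq hz hS
  have hSd : HasFDerivAt (repTM p S) (fderiv ℝ (repTM p S) (tchart p u)) (tchart p u) :=
    (hS1.differentiableAt one_ne_zero).hasFDerivAt
  -- The base part of `S` is `y`, so its derivative along `(0, w)` is `w`. The bracket thus adds a
  -- second copy of `w` to that of the complete lift, and the factor `1/2` restores `w`.
  have h4 : ∀ c : E × E, (fderiv ℝ (repTM p S) (tchart p u) c).1 = c.2 := fun c =>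
    DFunLike.congr_fun ((hSd.fst.congr_of_eventuallyEq hSfst.symm).unique hasFDerivAt_snd) c
  -- This term cancels the fibre part of the complete lift, so no derivative of the chosen extension
  -- of `w` survives.
  have h5 : fderiv ℝ (fun z : E × E => ((0 : E), repBase p X z.1)) (tchart p u)
      (repTM p S (tchart p u)) = (0, fderiv ℝ (repBase p X) (tchart p u).1 (tchart p u).2) := by
    rw [← hSfst.eq_of_nhds]
    have h := HasFDerivAt.fderiv (f := fun z : E × E => ((0 : E), repBase p X z.1))
      ((hasFDerivAt_const (0 : E) (tchart p u)).prodMk ((hXd.differentiableAt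
      one_ne_zero).hasFDerivAt.comp (tchart p u) hasFDerivAt_fst))
    rw [h]
    rfl
  have h6 : repBase p X (tchart p u).1 = fibreCoord p u.proj w := by
    rw [← repAlong_basic hz]
    simp only [repAlong, basic]
    rw [symm_tchart hu, hXw]
  have h7 : dtchart p u (connection S u w) = (1 / 2 : ℝ) • (dtchart p u (completeLift X u) +
      dtchart p u (bracket (fun u => vert u (basic X u)) S u)) := by
    rw [← map_add, ← map_smul]; rfl
  rw [h7, h3, h1, VectorField.lieBracket_eq]
  simp only
  rw [h5, h6, hXw]
  have h8 := h4 (0, fibreCoord p u.proj w)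
  refine Prod.ext ?_ ?_
  · simp only [Prod.smul_fst, Prod.fst_add, Prod.fst_sub, h8, sub_zero]
    rw [← two_smul ℝ (fibreCoord p u.proj w), smul_smul]
    norm_num
  · simp only [Prod.smul_snd, Prod.snd_add, Prod.snd_sub]
    congr 1
    abel

/-- The connection coefficients of `S` in the chart `tchart p`. -/
def coeff (p : M) (S : FieldTM E M) (z : E × E) : E →L[ℝ] E :=
  -(1 / 2 : ℝ) • (ContinuousLinearMap.snd ℝ E E ∘L fderiv ℝ (repTM p S) z ∘L
    ContinuousLinearMap.inr ℝ E E)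

/-- The part of the chart `tchart p` over which sprays are smooth. -/
def slitTarget (p : M) : Set (E × E) :=
  (tchart p : PartialEquiv (TM E M) (E × E)).target ∩ {z | z.2 ≠ 0}

lemma isOpen_slitTarget (p : M) : IsOpen (slitTarget (E := E) p) :=
  (isOpen_tchart_target p).inter (isOpen_ne_fun continuous_snd continuous_const)

lemma symm_mem_slit {p : M} {z : E × E} (hz : z ∈ slitTarget p) :
    ((tchart p : PartialEquiv (TM E M) _).symm z) ∈ slit E M := by
  intro h
  refine hz.2 ?_
  rw [← fibreCoord_symm hz.1, h, map_zero]

lemma tchart_mem_slitTarget {p : M} {u : TM E M} (hu : u.proj ∈ (chartAt E p).source)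
    (h : u ∈ slit E M) : tchart p u ∈ slitTarget p := by
  refine ⟨(tchart p).map_source (mem_tchart_source.2 hu), fun h0 => h ?_⟩
  rw [tchart_apply hu] at h0
  exact (fibreCoord_isInvertible hu).injective (h0.trans (map_zero _).symm)

lemma isOpen_slit : IsOpen (slit E M) := by
  rw [isOpen_iff_mem_nhds]
  intro u hu
  have hs := mem_chart_source E u.proj
  have h1 := (tchart_contMDiffAt hs).continuousAt.preimage_mem_nhds
    ((isOpen_slitTarget u.proj).mem_nhds (tchart_mem_slitTarget hs hu))
  filter_upwards [h1, (isOpen_tchart_source u.proj).mem_nhds (mem_tchart_source.2 hs)] with w hw hw'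
  rw [← symm_tchart (mem_tchart_source.1 hw')]
  exact symm_mem_slit hw

lemma IsSpray.contDiffAt_repTM {S : FieldTM E M} (hS : IsSpray S) {p : M} {z : E × E}
    (hz : z ∈ slitTarget p) : ContDiffAt ℝ ∞ (repTM p S) z := by
  rw [← (tchart p : PartialEquiv (TM E M) _).right_inv hz.1]
  exact (contMDiffAt_iff_repTM (n := ⊤) (symm_proj_mem hz.1)).1
    (hS.smoothOn.contMDiffAt (isOpen_slit.mem_nhds (symm_mem_slit hz)))

lemma IsSpray.contDiffAt_coeff {S : FieldTM E M} (hS : IsSpray S) {p : M} {z : E × E}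
    (hz : z ∈ slitTarget p) : ContDiffAt ℝ ∞ (coeff p S) z := by
  have h := (hS.contDiffAt_repTM hz).fderiv_right (m := ∞) (by simp)
  have h2 : ContDiffAt ℝ ∞ (fun z => ContinuousLinearMap.snd ℝ E E ∘L fderiv ℝ (repTM p S) z ∘L
      ContinuousLinearMap.inr ℝ E E) z :=
    contDiffAt_const.clm_comp (h.clm_comp contDiffAt_const)
  exact h2.const_smul (-(1 / 2 : ℝ))

lemma repTM_connection {S : FieldTM E M} (hS : IsSpray S) {p : M} {z : E × E}
    (hz : z ∈ slitTarget p) (Y : FieldAlong E M) :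
    repTM p (fun u => connection S u (Y u)) z =
      (repAlong p Y z, -coeff p S z (repAlong p Y z)) := by
  have h1 := hS.contDiffAt_repTM hz
  have hr := (tchart p : PartialEquiv (TM E M) _).right_inv hz.1
  rw [← hr] at h1
  have h2 := dtchart_connection (symm_proj_mem hz.1) hS.proj_eq (h1.of_le (by exact_mod_cast le_top))
    (Y ((tchart p).symm z))
  rw [hr] at h2
  refine h2.trans (Prod.ext rfl ?_)
  simp [coeff, repAlong]

lemma dtchart_injective {p : M} {u : TM E M} (hu : u.proj ∈ (chartAt E p).source) :
    Function.Injective (dtchart p u) := (dtchart_isInvertible hu).injective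

/-- `verticalMap` uses `Function.invFun`, whose value is meaningful only on the image of `𝐢`; that
image contains every vector with zero base component. -/
lemma exists_vert_eq {p : M} {u : TM E M} (hu : u.proj ∈ (chartAt E p).source) {ξ : TTM u}
    (hξ : (dtchart p u ξ).1 = 0) : ∃ w, vert u w = ξ := by
  obtain ⟨w, hw⟩ := (fibreCoord_isInvertible hu).surjective (dtchart p u ξ).2
  exact ⟨w, dtchart_injective hu ((dtchart_vert hu w).trans (Prod.ext hξ.symm hw))⟩

/-- The vertical map in coordinates. -/
lemma repAlong_verticalMap {S : FieldTM E M} (hS : IsSpray S) {p : M} {z : E × E}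
    (hz : z ∈ slitTarget p) (ξ : FieldTM E M) :
    repAlong p (fun u => verticalMap (connection S) u (ξ u)) z =
      (repTM p ξ z).2 + coeff p S z (repTM p ξ z).1 := by
  set u := (tchart p : PartialEquiv (TM E M) _).symm z with hu
  have hup : u.proj ∈ (chartAt E p).source := symm_proj_mem hz.1
  have h1 : dtchart p u (ξ u - connection S u (proj u (ξ u))) =
      (0, (repTM p ξ z).2 + coeff p S z (repTM p ξ z).1) := by
    have h := repTM_connection hS hz (fun u => proj u (ξ u))
    rw [repAlong_proj hz.1] at h
    rw [map_sub]
    change repTM p ξ z - repTM p (fun u => connection S u (proj u (ξ u))) z = _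
    rw [h]
    refine Prod.ext (sub_self _) ?_
    simp
  have h2 : vert u (verticalMap (connection S) u (ξ u)) =
      ξ u - connection S u (proj u (ξ u)) :=
    Function.invFun_eq (exists_vert_eq hup (by rw [h1]))
  rw [← h2, dtchart_vert hup] at h1
  exact congrArg Prod.snd h1

/-! ### The Berwald derivative and its curvature in coordinates -/

lemma fderiv_prodMk_apply {F G G' : Type*} [NormedAddCommGroup F] [NormedSpace ℝ F]
    [NormedAddCommGroup G] [NormedSpace ℝ G] [NormedAddCommGroup G'] [NormedSpace ℝ G']
    {a : F → G} {b : F → G'} {z : F} (ha : DifferentiableAt ℝ a z) (hb : DifferentiableAt ℝ b z)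
    (c : F) : fderiv ℝ (fun z => (a z, b z)) z c = (fderiv ℝ a z c, fderiv ℝ b z c) := by
  rw [ha.fderiv_prodMk hb]; rfl

lemma fderiv_clm_apply_apply {F G G' : Type*} [NormedAddCommGroup F] [NormedSpace ℝ F]
    [NormedAddCommGroup G] [NormedSpace ℝ G] [NormedAddCommGroup G'] [NormedSpace ℝ G']
    {N : F → G →L[ℝ] G'} {b : F → G} {z : F} (hN : DifferentiableAt ℝ N z)
    (hb : DifferentiableAt ℝ b z) (c : F) :
    fderiv ℝ (fun z => N z (b z)) z c = N z (fderiv ℝ b z c) + fderiv ℝ N z c (b z) := by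
  rw [fderiv_clm_apply hN hb]; rfl

section Derivatives

variable {S : FieldTM E M} {p : M} {z : E × E}

lemma repTM_vert_eventuallyEq (hz : z ∈ slitTarget p) (X : FieldAlong E M) :
    repTM p (fun u => vert u (X u)) =ᶠ[𝓝 z] fun z => (0, repAlong p X z) := by
  filter_upwards [(isOpen_slitTarget p).mem_nhds hz] with y hy
  exact repTM_vert hy.1 X

lemma repTM_connection_eventuallyEq (hS : IsSpray S) (hz : z ∈ slitTarget p)
    (Y : FieldAlong E M) : repTM p (fun u => connection S u (Y u)) =ᶠ[𝓝 z]
      fun z => (repAlong p Y z, -coeff p S z (repAlong p Y z)) := by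
  filter_upwards [(isOpen_slitTarget p).mem_nhds hz] with y hy
  exact repTM_connection hS hy Y

lemma contDiffAt_repTM_vert {n : ℕ∞} (hz : z ∈ slitTarget p) {X : FieldAlong E M}
    (hX : ContDiffAt ℝ n (repAlong p X) z) :
    ContDiffAt ℝ n (repTM p (fun u => vert u (X u))) z :=
  (contDiffAt_const.prodMk hX).congr_of_eventuallyEq (repTM_vert_eventuallyEq hz X)

lemma contDiffAt_repTM_connection {n : ℕ∞} (hS : IsSpray S) (hz : z ∈ slitTarget p)
    {Y : FieldAlong E M} (hY : ContDiffAt ℝ n (repAlong p Y) z) :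
    ContDiffAt ℝ n (repTM p (fun u => connection S u (Y u))) z :=
  (hY.prodMk (((hS.contDiffAt_coeff hz).of_le (by exact_mod_cast le_top)).clm_apply
    hY).neg).congr_of_eventuallyEq (repTM_connection_eventuallyEq hS hz Y)

/-- The Lie bracket `[𝐢X, 𝓗Y]` in coordinates. -/
lemma repTM_bracket_vert_connection (hS : IsSpray S) (hz : z ∈ slitTarget p)
    {X Y : FieldAlong E M} (hX : ContDiffAt ℝ 1 (repAlong p X) z)
    (hY : ContDiffAt ℝ 1 (repAlong p Y) z) :
    repTM p (bracket (fun u => vert u (X u)) (fun u => connection S u (Y u))) z =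
      (fderiv ℝ (repAlong p Y) z (0, repAlong p X z),
        -(coeff p S z (fderiv ℝ (repAlong p Y) z (0, repAlong p X z)) +
          fderiv ℝ (coeff p S) z (0, repAlong p X z) (repAlong p Y z)) -
        fderiv ℝ (repAlong p X) z (repAlong p Y z, -coeff p S z (repAlong p Y z))) := by
  have hXd := hX.differentiableAt one_ne_zero
  have hYd := hY.differentiableAt one_ne_zero
  have hN : DifferentiableAt ℝ (coeff p S) z := (hS.contDiffAt_coeff hz).differentiableAt (by simp)
  rw [repTM_bracket hz.1 (contDiffAt_repTM_vert (n := 1) hz hX)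
      (contDiffAt_repTM_connection (n := 1) hS hz hY),
    (repTM_vert_eventuallyEq hz X).lieBracket_vectorField_eq
      (repTM_connection_eventuallyEq hS hz Y), VectorField.lieBracket_eq]
  simp only
  rw [fderiv_prodMk_apply hYd (hN.clm_apply hYd).fun_neg, fderiv_fun_neg,
    fderiv_prodMk_apply (differentiableAt_const _) hXd, _root_.neg_apply,
    fderiv_clm_apply_apply hN hYd]
  simp

/-- The vertical derivative is plain differentiation along the fibre: the connection enters only the
component of the bracket that `𝐣` discards. -/
lemma repAlong_vDeriv (hS : IsSpray S) (hz : z ∈ slitTarget p)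
    {X Y : FieldAlong E M} (hX : ContDiffAt ℝ 1 (repAlong p X) z)
    (hY : ContDiffAt ℝ 1 (repAlong p Y) z) :
    repAlong p (vDeriv (connection S) X Y) z = fderiv ℝ (repAlong p Y) z (0, repAlong p X z) := by
  unfold vDeriv
  rw [repAlong_proj hz.1, repTM_bracket_vert_connection hS hz hX hY]

/-- The bracket contains derivatives of `X`, but the vertical map adds `N` of its base component,
which cancels them. The result depends on `X` only through its value at the point. -/
lemma repAlong_hDeriv (hS : IsSpray S) (hz : z ∈ slitTarget p)
    {X Y : FieldAlong E M} (hX : ContDiffAt ℝ 1 (repAlong p X) z)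
    (hY : ContDiffAt ℝ 1 (repAlong p Y) z) :
    repAlong p (hDeriv (connection S) X Y) z =
      fderiv ℝ (repAlong p Y) z (repAlong p X z, -coeff p S z (repAlong p X z)) +
        fderiv ℝ (coeff p S) z (0, repAlong p Y z) (repAlong p X z) := by
  unfold hDeriv
  have hsw : bracket (fun u => connection S u (X u)) (fun u => vert u (Y u)) =
      fun u => -bracket (fun u => vert u (Y u)) (fun u => connection S u (X u)) u := by
    funext u
    exact VectorField.mlieBracket_swap_apply
  have hneg : repTM p (bracket (fun u => connection S u (X u)) (fun u => vert u (Y u))) z =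
      -repTM p (bracket (fun u => vert u (Y u)) (fun u => connection S u (X u))) z := by
    rw [hsw]
    exact map_neg _ _
  rw [repAlong_verticalMap hS hz, hneg, repTM_bracket_vert_connection hS hz hY hX]
  simp only [Prod.snd_neg, Prod.fst_neg, map_neg]
  abel

/-- The Berwald derivative in coordinates. -/
lemma repAlong_berwaldDeriv (hS : IsSpray S) (hz : z ∈ slitTarget p)
    {ξ : FieldTM E M} {Y : FieldAlong E M} (hξ : ContDiffAt ℝ 1 (repTM p ξ) z)
    (hY : ContDiffAt ℝ 1 (repAlong p Y) z) :
    repAlong p (berwaldDeriv (connection S) ξ Y) z = fderiv ℝ (repAlong p Y) z (repTM p ξ z) +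
      fderiv ℝ (coeff p S) z (0, repAlong p Y z) (repTM p ξ z).1 := by
  have hv : repAlong p (fun u => verticalMap (connection S) u (ξ u)) =ᶠ[𝓝 z]
      fun z => (repTM p ξ z).2 + coeff p S z (repTM p ξ z).1 := by
    filter_upwards [(isOpen_slitTarget p).mem_nhds hz] with y hy
    exact repAlong_verticalMap hS hy ξ
  have hh : repAlong p (fun u => proj u (ξ u)) =ᶠ[𝓝 z] fun z => (repTM p ξ z).1 := by
    filter_upwards [(isOpen_slitTarget p).mem_nhds hz] with y hy
    exact repAlong_proj hy.1 ξ
  have hN := (hS.contDiffAt_coeff hz).of_le (m := 1) (by exact_mod_cast le_top)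
  have hv1 := ((hξ.snd.add (hN.clm_apply hξ.fst)).congr_of_eventuallyEq hv)
  have hh1 := (hξ.fst.congr_of_eventuallyEq hh)
  have h0 : repAlong p (berwaldDeriv (connection S) ξ Y) z =
      repAlong p (vDeriv (connection S) (fun u => verticalMap (connection S) u (ξ u)) Y) z +
      repAlong p (hDeriv (connection S) (fun u => proj u (ξ u)) Y) z := map_add _ _ _
  rw [h0, repAlong_vDeriv hS hz hv1 hY, repAlong_hDeriv hS hz hh1 hY, hv.eq_of_nhds,
    hh.eq_of_nhds, ← add_assoc, ← map_add]
  -- The vertical and horizontal parts of `ξ` recombine, so `Y` is differentiated along `ξ` itself.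
  have h1 : ((0 : E), (repTM p ξ z).2 + coeff p S z (repTM p ξ z).1) +
      ((repTM p ξ z).1, -coeff p S z (repTM p ξ z).1) = repTM p ξ z := by
    refine Prod.ext ?_ ?_ <;> simp
  rw [h1]

/-- The Berwald curvature in coordinates. -/
lemma repAlong_berwaldCurvature (hS : IsSpray S) (hz : z ∈ slitTarget p)
    {X Y Z : FieldAlong E M} (hX : ContDiffAt ℝ 2 (repAlong p X) z)
    (hY : ContDiffAt ℝ 2 (repAlong p Y) z) (hZ : ContDiffAt ℝ 2 (repAlong p Z) z) :
    repAlong p (berwaldCurvature (connection S) X Y Z) z =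
      fderiv ℝ (fderiv ℝ (coeff p S)) z (0, repAlong p X z) (0, repAlong p Z z)
        (repAlong p Y z) := by
  set ξ : FieldTM E M := fun u => vert u (X u) with hξ
  set η : FieldTM E M := fun u => connection S u (Y u) with hη
  have hξ2 : ContDiffAt ℝ 2 (repTM p ξ) z := contDiffAt_repTM_vert (n := 2) hz hX
  have hη2 : ContDiffAt ℝ 2 (repTM p η) z := contDiffAt_repTM_connection (n := 2) hS hz hY
  have hN := (hS.contDiffAt_coeff hz)
  have hN2 : ContDiffAt ℝ 1 (fderiv ℝ (coeff p S)) z :=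
    (hN.fderiv_right (m := ∞) (by simp)).of_le (by exact_mod_cast le_top)
  have hZ1 : ContDiffAt ℝ 1 (fderiv ℝ (repAlong p Z)) z := hZ.fderiv_right (by norm_num)
  have hD : ∀ ζ : FieldTM E M, ContDiffAt ℝ 2 (repTM p ζ) z →
      repAlong p (berwaldDeriv (connection S) ζ Z) =ᶠ[𝓝 z] fun z =>
      fderiv ℝ (repAlong p Z) z (repTM p ζ z) +
      fderiv ℝ (coeff p S) z (0, repAlong p Z z) (repTM p ζ z).1 := by
    intro ζ hζ
    filter_upwards [(isOpen_slitTarget p).mem_nhds hz, hζ.eventually (by simp),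
      hZ.eventually (by simp)] with y hy hζy hZy
    exact repAlong_berwaldDeriv hS hy (hζy.of_le one_le_two) (hZy.of_le one_le_two)
  have hc : ∀ ζ : FieldTM E M, ContDiffAt ℝ 2 (repTM p ζ) z → ContDiffAt ℝ 1 (fun z =>
      fderiv ℝ (repAlong p Z) z (repTM p ζ z) +
      fderiv ℝ (coeff p S) z (0, repAlong p Z z) (repTM p ζ z).1) z := fun ζ hζ =>
    (hZ1.clm_apply (hζ.of_le one_le_two)).add ((hN2.clm_apply
      (contDiffAt_const.prodMk (hZ.of_le one_le_two))).clm_apply (hζ.of_le one_le_two).fst)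
  have h0 : repAlong p (berwaldCurvature (connection S) X Y Z) z =
      repAlong p (berwaldDeriv (connection S) ξ (berwaldDeriv (connection S) η Z)) z -
      repAlong p (berwaldDeriv (connection S) η (berwaldDeriv (connection S) ξ Z)) z -
      repAlong p (berwaldDeriv (connection S) (bracket ξ η) Z) z := by
    exact (map_sub _ _ _).trans (congrArg₂ _ (map_sub _ _ _) rfl)
  have hbr : repTM p (bracket ξ η) =ᶠ[𝓝 z] VectorField.lieBracket ℝ (repTM p ξ) (repTM p η) := by
    filter_upwards [(isOpen_slitTarget p).mem_nhds hz, hξ2.eventually (by simp),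
      hη2.eventually (by simp)] with y hy h1 h2
    exact repTM_bracket hy.1 (h1.of_le one_le_two) (h2.of_le one_le_two)
  have hbr1 : ContDiffAt ℝ 1 (repTM p (bracket ξ η)) z :=
    (ContDiffAt.lieBracket_vectorField hξ2 hη2 (by norm_num)).congr_of_eventuallyEq hbr
  have hξ1 := hξ2.of_le one_le_two
  have hη1 := hη2.of_le one_le_two
  have hξv : repTM p ξ =ᶠ[𝓝 z] fun z => (0, repAlong p X z) := repTM_vert_eventuallyEq hz X
  have hXd := hX.differentiableAt (by simp)
  have hξz := hξv.eq_of_nhds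
  -- The base part of `𝐢X` vanishes identically, so its derivative does too. This removes many of
  -- the terms in which `DN` or `D²N` is applied to a base component.
  have hξf : ∀ c, (fderiv ℝ (repTM p ξ) z c).1 = 0 := fun c => by
    rw [hξv.fderiv_eq, fderiv_prodMk_apply (differentiableAt_const _) hXd]; simp
  have hηf : (repTM p η z).1 = repAlong p Y z := by
    rw [(repTM_connection_eventuallyEq hS hz Y).eq_of_nhds]
  rw [h0, repAlong_berwaldDeriv hS hz hξ1 ((hc η hη2).congr_of_eventuallyEq (hD η hη2)),
    repAlong_berwaldDeriv hS hz hη1 ((hc ξ hξ2).congr_of_eventuallyEq (hD ξ hξ2)),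
    repAlong_berwaldDeriv hS hz hbr1 (hZ.of_le one_le_two), (hD η hη2).fderiv_eq,
    (hD ξ hξ2).fderiv_eq, (hD η hη2).eq_of_nhds, (hD ξ hξ2).eq_of_nhds, hbr.eq_of_nhds,
    VectorField.lieBracket_eq]
  have hexp : ∀ ζ : FieldTM E M, ContDiffAt ℝ 2 (repTM p ζ) z → ∀ c, fderiv ℝ (fun z =>
      fderiv ℝ (repAlong p Z) z (repTM p ζ z) +
      fderiv ℝ (coeff p S) z (0, repAlong p Z z) (repTM p ζ z).1) z c =
      fderiv ℝ (repAlong p Z) z (fderiv ℝ (repTM p ζ) z c) +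
        fderiv ℝ (fderiv ℝ (repAlong p Z)) z c (repTM p ζ z) +
      (fderiv ℝ (coeff p S) z (0, repAlong p Z z) (fderiv ℝ (repTM p ζ) z c).1 +
        (fderiv ℝ (coeff p S) z (0, fderiv ℝ (repAlong p Z) z c) (repTM p ζ z).1 +
          fderiv ℝ (fderiv ℝ (coeff p S)) z c (0, repAlong p Z z) (repTM p ζ z).1)) := by
    intro ζ hζ c
    have a1 := hZ1.differentiableAt one_ne_zero
    have a2 := hζ.differentiableAt (by simp)
    have a3 := hN2.differentiableAt one_ne_zero
    have a4 : DifferentiableAt ℝ (fun z => ((0 : E), repAlong p Z z)) z :=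
      (differentiableAt_const _).prodMk (hZ.differentiableAt (by simp))
    rw [fderiv_fun_add (a1.clm_apply a2) ((a3.clm_apply a4).clm_apply a2.fst),
      _root_.add_apply, fderiv_clm_apply_apply a1 a2,
      fderiv_clm_apply_apply (a3.clm_apply a4) a2.fst, fderiv_clm_apply_apply a3 a4,
      fderiv_prodMk_apply (differentiableAt_const _) (hZ.differentiableAt (by simp)),
      _root_.add_apply, a2.hasFDerivAt.fst.fderiv]
    simp
  -- The second derivatives of `Z` cancel by symmetry and the first ones against the bracket term.
  -- What remains is `D²N` along `𝐢X`.
  have hsym : IsSymmSndFDerivAt ℝ (repAlong p Z) z := hZ.isSymmSndFDerivAt (by simp)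
  rw [hexp η hη2, hexp ξ hξ2, hsym.eq (repTM p ξ z) (repTM p η z)]
  simp only [map_sub, Prod.fst_sub, hξf, hηf]
  rw [hξz]
  simp
  abel

end Derivatives

/-! ### Restriction to a single tangent space -/

lemma fderiv_fibre {V : Type*} [NormedAddCommGroup V] [NormedSpace ℝ V] {G : E × E → V} {x y : E}
    (hG : DifferentiableAt ℝ G (x, y)) (c : E) :
    fderiv ℝ (fun y => G (x, y)) y c = fderiv ℝ G (x, y) (0, c) := by
  have h := hG.hasFDerivAt.comp y ((hasFDerivAt_const x y).prodMk (hasFDerivAt_id y))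
  have h' : HasFDerivAt (fun y => G (x, y)) _ y := h
  rw [h'.fderiv]
  rfl

/-- The fibre coordinate of a vector field on `TM`, restricted to the tangent space at `p`. -/
def spray₂ (S : FieldTM E M) (p : M) (y : E) : E := (S (⟨p, y⟩ : TM E M) : E × E).2

/-- The chart at `p` has identity derivative at `p`, so over `p` the fibre coordinate is the vector
itself and the base coordinate is fixed. -/
lemma tchart_fibre (p : M) (y : E) :
    tchart p (⟨p, y⟩ : TM E M) = (extChartAt 𝓘(ℝ, E) p p, y) := by
  rw [tchart_apply (u := ⟨p, y⟩) (mem_chart_source E p), fibreCoord_self]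
  rfl

lemma repTM_fibre (ξ : FieldTM E M) (p : M) (y : E) :
    repTM p ξ (extChartAt 𝓘(ℝ, E) p p, y) = ξ (⟨p, y⟩ : TM E M) := by
  unfold repTM
  rw [← tchart_fibre p y, symm_tchart (u := ⟨p, y⟩) (mem_chart_source E p)]
  exact DFunLike.congr_fun (dtchart_self (⟨p, y⟩ : TM E M)) _

lemma repAlong_fibre (X : FieldAlong E M) (v : TM E M) :
    repAlong v.proj X (tchart v.proj v) = X v := by
  unfold repAlong
  rw [symm_tchart (mem_chart_source E v.proj), fibreCoord_self]
  rfl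

lemma fibre_mem_slitTarget (p : M) {y : E} (hy : y ≠ 0) :
    (extChartAt 𝓘(ℝ, E) p p, y) ∈ slitTarget (E := E) p := by
  rw [← tchart_fibre]
  exact tchart_mem_slitTarget (u := ⟨p, y⟩) (mem_chart_source E p) hy

lemma vert_eq (v : TM E M) (w : TangentSpace 𝓘(ℝ, E) v.proj) :
    (vert v w : E × E) = ((0 : E), w) := by
  have h := dtchart_vert (mem_chart_source E v.proj) w
  rw [dtchart_self, fibreCoord_self] at h
  exact h

section Spray

variable {S : FieldTM E M} (hS : IsSpray S) (p : M)

include hS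

lemma IsSpray.contDiffAt_spray₂ {y : E} (hy : y ≠ 0) : ContDiffAt ℝ ∞ (spray₂ S p) y := by
  have h := (hS.contDiffAt_repTM (fibre_mem_slitTarget p hy)).comp y
    (contDiffAt_const.prodMk contDiffAt_id)
  refine h.snd.congr_of_eventuallyEq (Eventually.of_forall fun y => ?_)
  exact (congrArg Prod.snd (repTM_fibre S p y)).symm

lemma IsSpray.coeff_fibre {y : E} (hy : y ≠ 0) :
    coeff p S (extChartAt 𝓘(ℝ, E) p p, y) = -(1 / 2 : ℝ) • fderiv ℝ (spray₂ S p) y := by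
  ext w
  have hd := (hS.contDiffAt_repTM (fibre_mem_slitTarget p hy)).differentiableAt (by simp)
  have h1 : spray₂ S p = fun y => (repTM p S (extChartAt 𝓘(ℝ, E) p p, y)).2 := by
    funext y
    rw [repTM_fibre]; rfl
  have h2 := fderiv_fibre (G := fun z => (repTM p S z).2) hd.snd w
  rw [← h1, hd.hasFDerivAt.snd.fderiv] at h2
  rw [_root_.smul_apply, h2]
  rfl

lemma IsSpray.fderiv_coeff_fibre {y : E} (hy : y ≠ 0) (c : E) :
    fderiv ℝ (coeff p S) (extChartAt 𝓘(ℝ, E) p p, y) (0, c) =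
      -(1 / 2 : ℝ) • fderiv ℝ (fderiv ℝ (spray₂ S p)) y c := by
  have hd := (hS.contDiffAt_coeff (fibre_mem_slitTarget p hy)).differentiableAt (by simp)
  rw [← fderiv_fibre hd]
  have h1 : (fun y => coeff p S (extChartAt 𝓘(ℝ, E) p p, y)) =ᶠ[𝓝 y]
      fun y => -(1 / 2 : ℝ) • fderiv ℝ (spray₂ S p) y := by
    filter_upwards [isOpen_ne.mem_nhds hy] with y hy
    exact hS.coeff_fibre p hy
  rw [h1.fderiv_eq, fderiv_fun_const_smul (((hS.contDiffAt_spray₂ p hy).fderiv_right (m := ∞)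
    (by simp)).differentiableAt (by simp)) (-(1 / 2 : ℝ))]
  rfl

/-- Both derivatives are taken in fibre directions, so they commute with restriction to the fibre,
where `N` is `-½ Ds`. -/
lemma IsSpray.fderiv_fderiv_coeff_fibre {y : E} (hy : y ≠ 0) (a c : E) :
    fderiv ℝ (fderiv ℝ (coeff p S)) (tchart p (⟨p, y⟩ : TM E M)) (0, a) (0, c) =
      -(1 / 2 : ℝ) • fderiv ℝ (fderiv ℝ (fderiv ℝ (spray₂ S p))) y a c := by
  rw [tchart_fibre]
  have hd := ((hS.contDiffAt_coeff (fibre_mem_slitTarget p hy)).fderiv_right (m := ∞)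
    (by simp)).differentiableAt (by simp)
  have hd' := (((hS.contDiffAt_spray₂ p hy).fderiv_right (m := ∞) (by simp)).fderiv_right (m := ∞)
    (by simp)).differentiableAt (by simp)
  have h1 : (fun y => fderiv ℝ (coeff p S) (extChartAt 𝓘(ℝ, E) p p, y) (0, c)) =ᶠ[𝓝 y]
      fun y => -(1 / 2 : ℝ) • fderiv ℝ (fderiv ℝ (spray₂ S p)) y c := by
    filter_upwards [isOpen_ne.mem_nhds hy] with y hy
    exact hS.fderiv_coeff_fibre p hy c
  have h2 := DFunLike.congr_fun (h1.fderiv_eq (𝕜 := ℝ)) a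
  rw [fderiv_fibre (G := fun z => fderiv ℝ (coeff p S) z (0, c))
    (hd.clm_apply (differentiableAt_const _)), fderiv_fun_const_smul
    (hd'.clm_apply (differentiableAt_const _)) (-(1 / 2 : ℝ)), _root_.smul_apply,
    fderiv_clm_apply_apply hd (differentiableAt_const _),
    fderiv_clm_apply_apply hd' (differentiableAt_const _)] at h2
  simpa using h2

omit p in
/-- The Berwald curvature of a spray is the third derivative of its spray coefficients. -/
theorem IsSpray.berwaldCurvature_eq {v : TM E M} (hv : v ∈ slit E M) {X Y Z : FieldAlong E M}
    (hX : ContMDiffAt 𝓘(ℝ, E).tangent 𝓘(ℝ, E).tangent ∞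
      (fun v : TM E M => (⟨v.proj, X v⟩ : TM E M)) v)
    (hY : ContMDiffAt 𝓘(ℝ, E).tangent 𝓘(ℝ, E).tangent ∞
      (fun v : TM E M => (⟨v.proj, Y v⟩ : TM E M)) v)
    (hZ : ContMDiffAt 𝓘(ℝ, E).tangent 𝓘(ℝ, E).tangent ∞
      (fun v : TM E M => (⟨v.proj, Z v⟩ : TM E M)) v) :
    berwaldCurvature (connection S) X Y Z v =
      (-(1 / 2 : ℝ) • fderiv ℝ (fderiv ℝ (fderiv ℝ (spray₂ S v.proj))) v.2 (X v) (Z v) (Y v) : E) := by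
  have hs := mem_chart_source E v.proj
  have hc : ∀ {X : FieldAlong E M}, ContMDiffAt 𝓘(ℝ, E).tangent 𝓘(ℝ, E).tangent ∞
      (fun v : TM E M => (⟨v.proj, X v⟩ : TM E M)) v →
      ContDiffAt ℝ 2 (repAlong v.proj X) (tchart v.proj v) := fun h =>
    (contDiffAt_repAlong (n := ⊤) hs h).of_le (by simpa using! ENat.LEInfty.out)
  have h := repAlong_berwaldCurvature hS (tchart_mem_slitTarget hs hv) (hc hX) (hc hY) (hc hZ)
  rw [repAlong_fibre, repAlong_fibre, repAlong_fibre, repAlong_fibre] at h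
  rw [h]
  have h2 := hS.fderiv_fderiv_coeff_fibre v.proj hv (X v) (Z v)
  exact DFunLike.congr_fun h2 (Y v)

/-- The spray coefficients are positively homogeneous of degree two. -/
lemma IsSpray.fderiv_spray₂_self {y : E} (hy : y ≠ 0) :
    fderiv ℝ (spray₂ S p) y y = (2 : ℝ) • spray₂ S p y := by
  have hz := fibre_mem_slitTarget p hy
  have hev : repTM p (liouville (E := E) (M := M)) =ᶠ[𝓝 (extChartAt 𝓘(ℝ, E) p p, y)]
      fun z => (0, z.2) := by
    filter_upwards [(isOpen_tchart_target p).mem_nhds hz.1] with z hz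
    exact (repTM_vert hz (fun v => v.2)).trans (Prod.ext rfl (fibreCoord_symm hz))
  have hd := hS.contDiffAt_repTM hz
  have h1 := repTM_bracket (ξ := liouville) hz.1
    ((contDiffAt_const.prodMk contDiffAt_snd).congr_of_eventuallyEq hev)
    (hd.of_le (by exact_mod_cast le_top))
  rw [show bracket liouville S = S from funext hS.homogeneous,
    hev.lieBracket_vectorField_eq EventuallyEq.rfl, VectorField.lieBracket_eq] at h1
  simp only at h1
  rw [fderiv_prodMk_apply (differentiableAt_const _) differentiableAt_snd, repTM_fibre] at h1
  have h3 : spray₂ S p = fun y => (repTM p S (extChartAt 𝓘(ℝ, E) p p, y)).2 := by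
    funext y
    rw [repTM_fibre]; rfl
  have hdd := hd.differentiableAt (by simp)
  have h4 := fderiv_fibre (G := fun z => (repTM p S z).2) hdd.snd y
  rw [← h3, hdd.hasFDerivAt.snd.fderiv] at h4
  have h5 := congrArg Prod.snd h1
  rw [fderiv_snd] at h5
  -- The fibre component of `S = [C, S]`.
  have h6 : spray₂ S p y = fderiv ℝ (spray₂ S p) y y - spray₂ S p y := by
    rw [h4]; exact h5
  rw [two_smul, eq_sub_iff_add_eq.1 h6]

end Spray

/-! ### The projective factor on a tangent space -/

/-- The projective factor, restricted to the tangent space at `p`. -/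
def factor (P : TM E M → ℝ) (p : M) (y : E) : ℝ := P ⟨p, y⟩

section Change

variable {S S' : FieldTM E M} {P : TM E M → ℝ} (h : IsProjectiveChange S S' P)

include h

lemma IsProjectiveChange.spray₂_eq (p : M) (y : E) :
    spray₂ S' p y = spray₂ S p y - (2 : ℝ) • factor P p y • y := by
  have h1 := congrArg (fun ξ : E × E => ξ.2) (h.eq (⟨p, y⟩ : TM E M))
  refine h1.trans ?_
  have h2 := vert_eq (⟨p, y⟩ : TM E M) y
  have h3 : ((liouville (⟨p, y⟩ : TM E M)) : E × E) = (0, y) := h2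
  change spray₂ S p y - (2 * P ⟨p, y⟩) • ((liouville (⟨p, y⟩ : TM E M)) : E × E).2 = _
  rw [h3, mul_smul]; rfl

lemma IsProjectiveChange.contDiffAt_factor (p : M) {y : E} (hy : y ≠ 0) :
    ContDiffAt ℝ ∞ (factor P p) y := by
  have h1 : ContMDiffAt 𝓘(ℝ, E).tangent 𝓘(ℝ, ℝ) ∞ P ⟨p, y⟩ :=
    h.smoothOn.contMDiffAt (isOpen_slit.mem_nhds hy)
  have hz := (fibre_mem_slitTarget p hy).1
  have h2 := (tchart_symm_contMDiffAt hz).comp y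
    ((contDiffAt_const (c := extChartAt 𝓘(ℝ, E) p p)).prodMk contDiffAt_id).contMDiffAt
  have hp : ∀ y : E, (tchart p).symm (extChartAt 𝓘(ℝ, E) p p, y) = (⟨p, y⟩ : TM E M) := fun y => by
    rw [← tchart_fibre, symm_tchart (u := ⟨p, y⟩) (mem_chart_source E p)]
  have h3 := ContMDiffAt.comp (I' := 𝓘(ℝ, E).tangent) (g := P) y (by
    change ContMDiffAt 𝓘(ℝ, E).tangent 𝓘(ℝ, ℝ) ∞ P ((tchart p).symm (_, y))
    rw [hp]
    exact h1) h2
  rw [← contMDiffAt_iff_contDiffAt]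
  refine h3.congr_of_eventuallyEq (Eventually.of_forall fun y => ?_)
  exact congrArg P (hp y).symm

lemma IsProjectiveChange.continuous_factor (p : M) : Continuous (factor P p) :=
  h.continuous.comp (FiberBundle.continuous_totalSpaceMk E (TangentSpace 𝓘(ℝ, E) : M → Type _) p)

/-- Both spray coefficients are homogeneous of degree two, hence so is their difference `2P y`.
Euler's relation for it gives `DP(y) y • y = P(y) • y`, and `y ≠ 0` can be cancelled. -/
lemma IsProjectiveChange.fderiv_factor_self (p : M) {y : E} (hy : y ≠ 0) :
    fderiv ℝ (factor P p) y y = factor P p y := by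
  have hf := (h.contDiffAt_factor p hy).differentiableAt (by simp)
  have hs := (h.isSpray.contDiffAt_spray₂ p hy).differentiableAt (by simp)
  have h1 := h.isSpray'.fderiv_spray₂_self p hy
  rw [show spray₂ S' p = fun y => spray₂ S p y - (2 : ℝ) • factor P p y • y from
    funext (h.spray₂_eq p),
    fderiv_fun_sub hs ((hf.fun_smul differentiableAt_fun_id).fun_const_smul (2 : ℝ)),
    fderiv_fun_const_smul (hf.fun_smul differentiableAt_fun_id) (2 : ℝ),
    fderiv_fun_smul hf differentiableAt_fun_id] at h1
  simp only [_root_.sub_apply, h.isSpray.fderiv_spray₂_self p hy] at h1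
  have h2 : fderiv ℝ (factor P p) y y • y = factor P p y • y := by
    simp only [_root_.smul_apply, _root_.add_apply, fderiv_fun_id, ContinuousLinearMap.id_apply,
      ContinuousLinearMap.smulRight_apply] at h1
    linear_combination (norm := module) (-1 / 2 : ℝ) • h1
  exact smul_left_injective ℝ hy h2

end Change

/-! ### Calculus of functions on a vector space satisfying Euler's relation -/

section Fibre

variable {f : E → ℝ}

lemma fderiv_smul_self (hf : ∀ y ≠ 0, ContDiffAt ℝ ∞ f y) {y : E} (hy : y ≠ 0) :
    fderiv ℝ (fun y => f y • y) y = f y • ContinuousLinearMap.id ℝ E +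
      (fderiv ℝ f y).smulRight y := by
  rw [fderiv_fun_smul ((hf y hy).differentiableAt (by simp)) differentiableAt_fun_id]
  simp

lemma fderiv_fderiv_smul_self (hf : ∀ y ≠ 0, ContDiffAt ℝ ∞ f y) {y : E} (hy : y ≠ 0) (c b : E) :
    fderiv ℝ (fderiv ℝ (fun y => f y • y)) y c b =
      fderiv ℝ f y c • b + (fderiv ℝ (fderiv ℝ f) y c b • y + fderiv ℝ f y b • c) := by
  have h1 : (fun y => fderiv ℝ (fun y => f y • y) y b) =ᶠ[𝓝 y]
      fun y => f y • b + fderiv ℝ f y b • y := by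
    filter_upwards [isOpen_ne.mem_nhds hy] with y hy
    rw [fderiv_smul_self hf hy]; rfl
  have hfs := hf y hy
  have hf1 := hfs.differentiableAt (by simp)
  have hf2 := (hfs.fderiv_right (m := ∞) (by simp)).differentiableAt (by simp)
  have hg := (((hfs.smul contDiffAt_id).fderiv_right (m := ∞) (by simp))).differentiableAt (by simp)
  have h2 := DFunLike.congr_fun (h1.fderiv_eq (𝕜 := ℝ)) c
  rw [fderiv_clm_apply_apply (N := fderiv ℝ (fun y => f y • y)) hg (differentiableAt_const _),
    fderiv_fun_add (hf1.smul_const _)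
      ((hf2.clm_apply (differentiableAt_const _)).fun_smul differentiableAt_fun_id),
    fderiv_fun_smul (hf2.clm_apply (differentiableAt_const _)) differentiableAt_fun_id,
    fderiv_fun_smul hf1 (differentiableAt_const _)] at h2
  simp [fderiv_clm_apply_apply hf2 (differentiableAt_const _)] at h2
  rw [h2, add_comm (fderiv ℝ f y b • c)]

/-- Leibniz' rule: the identity has no second derivative, so beside `D³f • y` there is one term for
each slot that differentiates the factor `y`. -/
lemma fderiv_fderiv_fderiv_smul_self (hf : ∀ y ≠ 0, ContDiffAt ℝ ∞ f y) {y : E} (hy : y ≠ 0)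
    (a c b : E) :
    fderiv ℝ (fderiv ℝ (fderiv ℝ (fun y => f y • y))) y a c b =
      fderiv ℝ (fderiv ℝ f) y a c • b + (fderiv ℝ (fderiv ℝ (fderiv ℝ f)) y a c b • y +
        fderiv ℝ (fderiv ℝ f) y c b • a + fderiv ℝ (fderiv ℝ f) y a b • c) := by
  have h1 : (fun y => fderiv ℝ (fderiv ℝ (fun y => f y • y)) y c b) =ᶠ[𝓝 y]
      fun y => fderiv ℝ f y c • b + (fderiv ℝ (fderiv ℝ f) y c b • y + fderiv ℝ f y b • c) := by
    filter_upwards [isOpen_ne.mem_nhds hy] with y hy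
    exact fderiv_fderiv_smul_self hf hy c b
  have hfs := hf y hy
  have hs2 := hfs.fderiv_right (m := ∞) (by simp)
  have hf2 := hs2.differentiableAt (by simp)
  have hf3 := (hs2.fderiv_right (m := ∞) (by simp)).differentiableAt (by simp)
  have hg := (((hfs.smul contDiffAt_id).fderiv_right (m := ∞) (by simp)).fderiv_right (m := ∞)
    (by simp)).differentiableAt (by simp)
  have h2 := DFunLike.congr_fun (h1.fderiv_eq (𝕜 := ℝ)) a
  have d0 : ∀ b : E, DifferentiableAt ℝ (fun _ : E => b) y := fun b => differentiableAt_const b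
  have d1 : ∀ b : E, DifferentiableAt ℝ (fun y => fderiv ℝ f y b) y := fun b =>
    hf2.clm_apply (d0 b)
  have d2 : DifferentiableAt ℝ (fun y => fderiv ℝ (fderiv ℝ f) y c b) y :=
    (hf3.clm_apply (d0 c)).clm_apply (d0 b)
  rw [fderiv_clm_apply_apply (N := fun y => fderiv ℝ (fderiv ℝ (fun y => f y • y)) y c)
      (hg.clm_apply (d0 c)) (d0 b),
    fderiv_clm_apply_apply (N := fderiv ℝ (fderiv ℝ (fun y => f y • y))) hg (d0 c),
    fderiv_fun_add ((d1 c).smul_const _)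
      ((d2.fun_smul differentiableAt_fun_id).fun_add ((d1 b).smul_const _)),
    fderiv_fun_add (d2.fun_smul differentiableAt_fun_id) ((d1 b).smul_const _),
    fderiv_fun_smul d2 differentiableAt_fun_id, fderiv_fun_smul (d1 c) (d0 b),
    fderiv_fun_smul (d1 b) (d0 c)] at h2
  simp [fderiv_clm_apply_apply hf2 (d0 _), fderiv_clm_apply_apply (hf3.clm_apply (d0 c)) (d0 b),
    fderiv_clm_apply_apply hf3 (d0 c)] at h2
  rw [h2, add_comm (fderiv ℝ (fderiv ℝ f) y c b • a)]

/-- Differentiate Euler's relation once along `c`: the terms `Df(c)` on both sides cancel. -/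
lemma fderiv_fderiv_apply_self (hf : ∀ y ≠ 0, ContDiffAt ℝ ∞ f y)
    (h1 : ∀ y ≠ 0, fderiv ℝ f y y = f y) {y : E} (hy : y ≠ 0) (c : E) :
    fderiv ℝ (fderiv ℝ f) y c y = 0 := by
  have h : (fun y => fderiv ℝ f y y) =ᶠ[𝓝 y] f := by
    filter_upwards [isOpen_ne.mem_nhds hy] with y hy
    exact h1 y hy
  have h2 := DFunLike.congr_fun (h.fderiv_eq (𝕜 := ℝ)) c
  rw [fderiv_clm_apply_apply ((((hf y hy).fderiv_right (m := ∞) (by simp))).differentiableAt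
    (by simp)) differentiableAt_fun_id] at h2
  simpa using h2

/-- Differentiate `D²f(y, b) = 0` along `c`; symmetry of the second and third derivatives puts `y`
in the first slot. This is Euler's relation of degree `-1` for `D²f`. -/
lemma fderiv_fderiv_fderiv_self_apply (hf : ∀ y ≠ 0, ContDiffAt ℝ ∞ f y)
    (h1 : ∀ y ≠ 0, fderiv ℝ f y y = f y) {y : E} (hy : y ≠ 0) (c b : E) :
    fderiv ℝ (fderiv ℝ (fderiv ℝ f)) y y c b = -fderiv ℝ (fderiv ℝ f) y c b := by
  have hs : ∀ {y : E}, y ≠ 0 → IsSymmSndFDerivAt ℝ f y := fun hy =>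
    (hf _ hy).isSymmSndFDerivAt (by simpa using! ENat.LEInfty.out)
  have hs2 := (hf y hy).fderiv_right (m := ∞) (by simp)
  have hf3 := (hs2.fderiv_right (m := ∞) (by simp)).differentiableAt (by simp)
  have hs' : IsSymmSndFDerivAt ℝ (fderiv ℝ f) y :=
    hs2.isSymmSndFDerivAt (by simpa using! ENat.LEInfty.out)
  have h : (fun y => fderiv ℝ (fderiv ℝ f) y y b) =ᶠ[𝓝 y] fun _ => 0 := by
    filter_upwards [isOpen_ne.mem_nhds hy] with y hy
    rw [(hs hy).eq y b]
    exact fderiv_fderiv_apply_self hf h1 hy b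
  have h2 := DFunLike.congr_fun (h.fderiv_eq (𝕜 := ℝ)) c
  rw [fderiv_clm_apply_apply (hf3.clm_apply differentiableAt_fun_id) (differentiableAt_const _),
    fderiv_clm_apply_apply hf3 differentiableAt_fun_id] at h2
  rw [hs'.eq y c]
  simp at h2
  linarith

/-- The trace of the third derivative of `y ↦ f y • y`, for `f` positively homogeneous. -/
lemma sum_coord_fderiv_fderiv_fderiv_smul_self (hf : ∀ y ≠ 0, ContDiffAt ℝ ∞ f y)
    (h1 : ∀ y ≠ 0, fderiv ℝ f y y = f y) {y : E} (hy : y ≠ 0) (c b : E)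
    {ι : Type*} [Fintype ι] (e : Module.Basis ι ℝ E) :
    ∑ i, e.coord i (fderiv ℝ (fderiv ℝ (fderiv ℝ (fun y => f y • y))) y (e i) c b) =
      (Module.finrank ℝ E + 1) * fderiv ℝ (fderiv ℝ f) y c b := by
  have hsum : ∀ (L : E →ₗ[ℝ] ℝ) (w : E), ∑ i, L (e i) * e.coord i w = L w := by
    intro L w
    rw [show L w = L (∑ i, e.repr w i • e i) by rw [e.sum_repr], map_sum]
    exact Finset.sum_congr rfl fun i _ => by rw [map_smul, smul_eq_mul, mul_comm]; rfl
  have hs : IsSymmSndFDerivAt ℝ f y :=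
    (hf _ hy).isSymmSndFDerivAt (by simpa using! ENat.LEInfty.out)
  simp only [fderiv_fderiv_fderiv_smul_self hf hy, map_add, map_smul, smul_eq_mul,
    Finset.sum_add_distrib]
  -- The four Leibniz terms contract to `1`, `-1`, `n` and `1` times `D²f(c, b)`; the `-1` comes
  -- from Euler's relation and the `n` from the trace of the identity.
  have e1 := hsum ((fderiv ℝ (fderiv ℝ f) y).flip c).toLinearMap b
  have e2 := hsum (((fderiv ℝ (fderiv ℝ (fderiv ℝ f)) y).flip c).flip b).toLinearMap y
  have e3 := hsum ((fderiv ℝ (fderiv ℝ f) y).flip b).toLinearMap c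
  have e4 : ∑ i, e.coord i (e i) = Module.finrank ℝ E := by
    simp [Module.finrank_eq_card_basis e]
  simp only [ContinuousLinearMap.coe_coe, ContinuousLinearMap.flip_apply] at e1 e2 e3
  rw [e1, e2, e3, ← Finset.mul_sum, e4, fderiv_fderiv_fderiv_self_apply hf h1 hy, hs.eq b c]
  ring

/-- In dimension at least two the complement of zero is connected, so `Df` is a constant `L` there,
and Euler's relation reads `f = L`; density and continuity cover zero. On a line the claim fails for
`|y|`. -/
lemma eq_fderiv_of_fderiv_fderiv_eq_zero (hdim : 2 ≤ Module.finrank ℝ E) (hc : Continuous f)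
    (hf : ∀ y ≠ 0, ContDiffAt ℝ ∞ f y) (h1 : ∀ y ≠ 0, fderiv ℝ f y y = f y)
    (h2 : ∀ y ≠ 0, fderiv ℝ (fderiv ℝ f) y = 0) : ∃ L : E →L[ℝ] ℝ, ∀ y, f y = L y := by
  have hrank : 1 < Module.rank ℝ E := by
    rw [← Module.finrank_eq_rank]
    exact_mod_cast hdim
  have hconn : IsPreconnected ({0}ᶜ : Set E) :=
    (isConnected_compl_singleton_of_one_lt_rank hrank 0).isPreconnected
  have hnt : Nontrivial E := Module.nontrivial_of_finrank_pos (R := ℝ) (by omega)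
  obtain ⟨e, he⟩ := exists_ne (0 : E)
  have hconst : ∀ y ≠ 0, fderiv ℝ f y = fderiv ℝ f e := fun y hy =>
    isOpen_compl_singleton.is_const_of_fderiv_eq_zero hconn
      (fun y hy => ((((hf y hy).fderiv_right (m := ∞) (by simp))).differentiableAt
        (by simp)).differentiableWithinAt) (fun y hy => h2 y hy) hy he
  refine ⟨fderiv ℝ f e, fun y => congrFun (hc.ext_on (dense_compl_singleton (0 : E))
    (fderiv ℝ f e).continuous fun y hy => ?_) y⟩
  rw [← hconst y hy, h1 y hy]

end Fibre

/-! ### Smooth extensions and second-order vector fields -/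

section Existence

variable [T2Space M]

/-- Every tangent vector extends to a smooth vector field on `M`. -/
lemma exists_smooth_extension (p : M) (a : TangentSpace 𝓘(ℝ, E) p) :
    ∃ X : ∀ q : M, TangentSpace 𝓘(ℝ, E) q, X p = a ∧
      ContMDiff 𝓘(ℝ, E) 𝓘(ℝ, E).tangent ∞ (fun q => (⟨q, X q⟩ : TM E M)) := by
  obtain ⟨s, hs, hX⟩ := FiberBundle.exists_contMDiffOn_extend (k := ∞) 𝓘(ℝ, E) E a
  obtain ⟨t, hts, ht, hpt⟩ := mem_nhds_iff.1 hs
  obtain ⟨ρ, -, hρ⟩ := (SmoothBumpFunction.nhds_basis_tsupport (I := 𝓘(ℝ, E)) p).mem_iff.1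
    (ht.mem_nhds hpt)
  refine ⟨(ρ : M → ℝ) • FiberBundle.extend E a, ?_, ?_⟩
  · simp [FiberBundle.extend_apply_self]
  · exact ContMDiffOn.smul_section_of_tsupport ρ.contMDiff.contMDiffOn ht hρ (hX.mono hts)

lemma exists_smoothOnSlit (v : TM E M) (a : TangentSpace 𝓘(ℝ, E) v.proj) :
    ∃ X : FieldAlong E M, X v = a ∧ X.SmoothOnSlit := by
  obtain ⟨X, hX, hs⟩ := exists_smooth_extension v.proj a
  exact ⟨basic X, hX, (hs.comp (contMDiff_proj (TangentSpace 𝓘(ℝ, E) : M → Type _))).contMDiffOn⟩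

/-- A local second-order vector field, with vanishing spray coefficients in the chart at `p`. -/
def flatSecondOrder (p : M) : FieldTM E M := fun u =>
  (dtchart p u).inverse ((tchart p u).2, (0 : E))

lemma dtchart_flatSecondOrder {p : M} {u : TM E M} (hu : u.proj ∈ (chartAt E p).source) :
    dtchart p u (flatSecondOrder p u) = ((tchart p u).2, (0 : E)) := by
  obtain ⟨e, he⟩ := dtchart_isInvertible hu
  unfold flatSecondOrder
  rw [← he, ContinuousLinearMap.inverse_equiv]
  exact e.apply_symm_apply _

lemma proj_flatSecondOrder {p : M} {u : TM E M} (hu : u.proj ∈ (chartAt E p).source) :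
    proj u (flatSecondOrder p u) = u.2 := by
  refine (fibreCoord_isInvertible hu).injective ?_
  rw [fibreCoord_proj hu, dtchart_flatSecondOrder hu, tchart_apply hu]

lemma contMDiffOn_flatSecondOrder (p : M) :
    ContMDiffOn 𝓘(ℝ, E).tangent 𝓘(ℝ, E).tangent.tangent ∞
      (fun v => (⟨v, flatSecondOrder p v⟩ : TangentBundle 𝓘(ℝ, E).tangent (TM E M)))
      (tchart (E := E) p).source := by
  intro u hu
  have hu' := mem_tchart_source.1 hu
  refine ((contMDiffAt_iff_repTM (n := ⊤) hu').2 ?_).contMDiffWithinAt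
  refine (contDiffAt_snd.prodMk contDiffAt_const).congr_of_eventuallyEq
    (f₁ := repTM p (flatSecondOrder p)) (f := fun z : E × E => (z.2, (0 : E))) ?_
  filter_upwards [(isOpen_tchart_target p).mem_nhds ((tchart p).map_source hu)] with z hz
  refine (dtchart_flatSecondOrder (symm_proj_mem hz)).trans ?_
  rw [(tchart p).right_inv hz]

/-- There are second-order vector fields over `M`. -/
lemma exists_isSecondOrder [SecondCountableTopology M] : ∃ ξ : FieldTM E M, IsSecondOrder ξ := by
  have : LocallyCompactSpace M := ChartedSpace.locallyCompactSpace E M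
  have : SigmaCompactSpace M := inferInstance
  -- The condition `𝐣ξ(v) = v` is affine in `ξ`, so the flat local fields can be averaged with
  -- weights summing to one.
  obtain ⟨ρ, hρ⟩ := SmoothPartitionOfUnity.exists_isSubordinate 𝓘(ℝ, E) (s := (univ : Set M))
    isClosed_univ (fun p : M => (chartAt E p).source) (fun p => (chartAt E p).open_source)
    (fun p _ => mem_iUnion.2 ⟨p, mem_chart_source E p⟩)
  let t : M → FieldTM E M := fun p u => ρ p u.proj • flatSecondOrder p u
  have hπ : ContMDiff 𝓘(ℝ, E).tangent 𝓘(ℝ, E) ∞ (fun u : TM E M => u.proj) :=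
    contMDiff_proj (TangentSpace 𝓘(ℝ, E) : M → Type _)
  have hsub : ∀ p (u : TM E M), ρ p u.proj ≠ 0 → u.proj ∈ (chartAt E p).source := fun p u hu =>
    hρ p (subset_tsupport _ hu)
  have hfin : ∀ u : TM E M, (Function.support fun p => ρ p u.proj).Finite := fun u =>
    ρ.locallyFinite.point_finite u.proj
  refine ⟨fun u => ∑ᶠ p, t p u, ?_, fun u => ?_⟩
  · refine ContMDiff.finsum_section_of_locallyFinite ?_ fun p => ?_
    · refine (ρ.locallyFinite.preimage_continuous hπ.continuous).subset fun p u hu => ?_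
      intro h0
      refine hu ?_
      simp only [t]
      rw [show ρ p u.proj = 0 from h0, zero_smul]
    -- Outside the chart domain the value of `flatSecondOrder p` does not matter: the weight is
    -- supported inside.
    · refine ContMDiffOn.smul_section_of_tsupport (ψ := fun u : TM E M => ρ p u.proj)
        (((ρ p).contMDiff.comp hπ).contMDiffOn) (isOpen_tchart_source p) ?_
        (contMDiffOn_flatSecondOrder p)
      intro u hu
      rw [mem_tchart_source]
      exact hρ p (tsupport_comp_subset_preimage _ hπ.continuous hu)
  · have h1 : proj u (∑ᶠ p, t p u) = ∑ᶠ p, proj u (t p u) := by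
      refine AddMonoidHom.map_finsum (LinearMap.toAddMonoidHom (ContinuousLinearMap.toLinearMap
        (mfderiv 𝓘(ℝ, E).tangent 𝓘(ℝ, E) (fun u : TM E M => u.proj) u))) ?_
      refine (hfin u).subset fun p hp h0 => hp ?_
      simp only [t]
      rw [show ρ p u.proj = 0 from h0, zero_smul]
    have h2 : ∀ p, proj u (t p u) = ρ p u.proj • u.2 := fun p => by
      have h3 : proj u (t p u) = ρ p u.proj • proj u (flatSecondOrder p u) := map_smul _ _ _
      rw [h3]
      by_cases h0 : ρ p u.proj = 0
      · rw [h0, zero_smul, zero_smul]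
      · rw [proj_flatSecondOrder (hsub p u h0)]
    rw [h1]
    simp only [h2]
    rw [← finsum_smul' (hfin u), ρ.sum_eq_one (mem_univ _), one_smul]

end Existence

/-! ### Smoothness of the 1-form -/

/-- Basis vectors are nonzero, so testing on `w ≠ 0` suffices. This matters since `P` is smooth only
off the zero section. -/
lemma contMDiffAt_clm_of_apply {F : M → E →L[ℝ] ℝ} {q : M}
    (hF : ∀ w ≠ 0, ContMDiffAt 𝓘(ℝ, E) 𝓘(ℝ, ℝ) ∞ (fun x => F x w) q) :
    ContMDiffAt 𝓘(ℝ, E) 𝓘(ℝ, E →L[ℝ] ℝ) ∞ F q := by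
  let e := Module.finBasis ℝ E
  have h1 : F = fun x => ∑ i, F x (e i) • (LinearMap.toContinuousLinearMap (e.coord i)) := by
    funext x
    ext w
    rw [show F x w = F x (∑ i, e.repr w i • e i) by rw [e.sum_repr], map_sum,
      _root_.sum_apply]
    exact Finset.sum_congr rfl fun i _ => by rw [map_smul, smul_eq_mul, mul_comm]; rfl
  rw [h1]
  exact contMDiffAt_finsetSum fun i _ => (hF _ (e.ne_zero i)).smul contMDiffAt_const

/-- A component of `α` at `q` is the value of `P` at the vector over `q` with constant chart
components `w`. For `w ≠ 0` these vectors form a smooth curve-like family in the slit tangent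
manifold, where `P` is smooth. -/
lemma IsProjectiveChange.isOneForm {S S' : FieldTM E M} {P : TM E M → ℝ}
    (h : IsProjectiveChange S S' P) {α : ∀ p : M, TangentSpace 𝓘(ℝ, E) p →L[ℝ] ℝ}
    (hα : ∀ v, P v = α v.proj v.2) : IsOneForm α := by
  intro p
  rw [contMDiffAt_hom_bundle]
  refine ⟨contMDiffAt_id, contMDiffAt_clm_of_apply fun w hw => ?_⟩
  have hz := fibre_mem_slitTarget p hw
  have h1 : ContMDiffAt 𝓘(ℝ, E) 𝓘(ℝ, E × E) ∞ (fun q : M => (extChartAt 𝓘(ℝ, E) p q, w)) p :=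
    contMDiffAt_extChartAt.prodMk_space contMDiffAt_const
  have h2 : ContMDiffAt 𝓘(ℝ, E) 𝓘(ℝ, E).tangent ∞
      (fun q : M => (tchart p : PartialEquiv (TM E M) _).symm (extChartAt 𝓘(ℝ, E) p q, w)) p :=
    ContMDiffAt.comp p (g := (tchart p : PartialEquiv (TM E M) _).symm)
      (tchart_symm_contMDiffAt hz.1) h1
  have h3 : ContMDiffAt 𝓘(ℝ, E) 𝓘(ℝ, ℝ) ∞
      (fun q : M => P ((tchart p).symm (extChartAt 𝓘(ℝ, E) p q, w))) p :=
    ContMDiffAt.comp p (h.smoothOn.contMDiffAt (isOpen_slit.mem_nhds (symm_mem_slit hz))) h2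
  refine h3.congr_of_eventuallyEq ?_
  filter_upwards [(chartAt E p).open_source.mem_nhds (mem_chart_source E p)] with q hq
  let e := trivializationAt E (TangentSpace 𝓘(ℝ, E)) p
  have hb : q ∈ e.baseSet := hq
  have h4 : (tchart p).symm (extChartAt 𝓘(ℝ, E) p q, w) = (⟨q, e.symmL ℝ q w⟩ : TM E M) := by
    rw [← symm_tchart (u := ⟨q, e.symmL ℝ q w⟩) hq, tchart_apply (u := ⟨q, e.symmL ℝ q w⟩) hq]
    congr 2
    unfold fibreCoord
    rw [← TangentBundle.continuousLinearMapAt_trivializationAt hq]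
    exact (e.continuousLinearMapAt_symmL hb w).symm
  rw [h4, hα]
  simp [ContinuousLinearMap.inCoordinates]
  rfl

/-! ### Change of the Berwald curvature and the three equivalences -/

section Change

variable {S S' : FieldTM E M} {P : TM E M → ℝ}

lemma fderiv_sub_two_smul {V : Type*} [NormedAddCommGroup V] [NormedSpace ℝ V] {F G H : E → V}
    (hF : ∀ y ≠ 0, ContDiffAt ℝ ∞ F y) (hG : ∀ y ≠ 0, ContDiffAt ℝ ∞ G y)
    (hH : ∀ y ≠ 0, H y = F y - (2 : ℝ) • G y) :
    ∀ y ≠ 0, fderiv ℝ H y = fderiv ℝ F y - (2 : ℝ) • fderiv ℝ G y := by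
  intro y hy
  have h : H =ᶠ[𝓝 y] fun y => F y - (2 : ℝ) • G y := by
    filter_upwards [isOpen_ne.mem_nhds hy] with y hy
    exact hH y hy
  have dF := (hF y hy).differentiableAt (by simp)
  have dG := (hG y hy).differentiableAt (by simp)
  rw [h.fderiv_eq, fderiv_fun_sub dF (dG.fun_const_smul (2 : ℝ)), fderiv_fun_const_smul dG (2 : ℝ)]

lemma ContDiffAt.fderiv_of_ne_zero {V : Type*} [NormedAddCommGroup V] [NormedSpace ℝ V] {F : E → V}
    (hF : ∀ y ≠ 0, ContDiffAt ℝ ∞ F y) : ∀ y ≠ 0, ContDiffAt ℝ ∞ (fderiv ℝ F) y :=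
  fun y hy => (hF y hy).fderiv_right (by simp)

/-- The third derivative of `y ↦ P y • y` on the tangent space at `p`. -/
def factor₃ (P : TM E M → ℝ) (p : M) (y : E) : E →L[ℝ] E →L[ℝ] E →L[ℝ] E :=
  fderiv ℝ (fderiv ℝ (fderiv ℝ (fun y => factor P p y • y))) y

/-- The change of the Berwald curvature under the projective change with factor `P`. -/
def berwaldChange (P : TM E M → ℝ) (v : TM E M) (a c b : TangentSpace 𝓘(ℝ, E) v.proj) :
    TangentSpace 𝓘(ℝ, E) v.proj := factor₃ P v.proj v.2 a c b

set_option synthInstance.maxHeartbeats 200000 in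
lemma IsProjectiveChange.fderiv₃_spray₂ (h : IsProjectiveChange S S' P) (p : M) {y : E}
    (hy : y ≠ 0) : fderiv ℝ (fderiv ℝ (fderiv ℝ (spray₂ S' p))) y =
      fderiv ℝ (fderiv ℝ (fderiv ℝ (spray₂ S p))) y - (2 : ℝ) • factor₃ P p y := by
  have hF : ∀ y ≠ 0, ContDiffAt ℝ ∞ (spray₂ S p) y := fun y hy => h.isSpray.contDiffAt_spray₂ p hy
  have hG : ∀ y ≠ 0, ContDiffAt ℝ ∞ (fun y => factor P p y • y) y := fun y hy =>
    (h.contDiffAt_factor p hy).smul contDiffAt_id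
  have h1 := fderiv_sub_two_smul hF hG fun y _ => h.spray₂_eq p y
  have h2 := fderiv_sub_two_smul (ContDiffAt.fderiv_of_ne_zero hF)
    (ContDiffAt.fderiv_of_ne_zero hG) h1
  exact fderiv_sub_two_smul (ContDiffAt.fderiv_of_ne_zero (ContDiffAt.fderiv_of_ne_zero hF))
    (ContDiffAt.fderiv_of_ne_zero (ContDiffAt.fderiv_of_ne_zero hG)) h2 y hy

/-- The change of the Berwald curvature under a projective change. -/
lemma IsProjectiveChange.berwaldCurvature_eq (h : IsProjectiveChange S S' P) {v : TM E M}
    (hv : v ∈ slit E M) {X Y Z : FieldAlong E M}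
    (hX : ContMDiffAt 𝓘(ℝ, E).tangent 𝓘(ℝ, E).tangent ∞
      (fun v : TM E M => (⟨v.proj, X v⟩ : TM E M)) v)
    (hY : ContMDiffAt 𝓘(ℝ, E).tangent 𝓘(ℝ, E).tangent ∞
      (fun v : TM E M => (⟨v.proj, Y v⟩ : TM E M)) v)
    (hZ : ContMDiffAt 𝓘(ℝ, E).tangent 𝓘(ℝ, E).tangent ∞
      (fun v : TM E M => (⟨v.proj, Z v⟩ : TM E M)) v) :
    berwaldCurvature (connection S') X Y Z v = berwaldCurvature (connection S) X Y Z v +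
      berwaldChange P v (X v) (Z v) (Y v) := by
  rw [h.isSpray.berwaldCurvature_eq hv hX hY hZ, h.isSpray'.berwaldCurvature_eq hv hX hY hZ]
  have key : ∀ x z y u : E, u ≠ 0 →
      -(1 / 2 : ℝ) • fderiv ℝ (fderiv ℝ (fderiv ℝ (spray₂ S' v.proj))) u x z y =
      -(1 / 2 : ℝ) • fderiv ℝ (fderiv ℝ (fderiv ℝ (spray₂ S v.proj))) u x z y +
        factor₃ P v.proj u x z y := by
    intro x z y u hu
    rw [h.fderiv₃_spray₂ v.proj hu]
    simp only [_root_.sub_apply, _root_.smul_apply]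
    module
  exact key _ _ _ _ hv

lemma FieldAlong.SmoothOnSlit.contMDiffAt {X : FieldAlong E M} (hX : X.SmoothOnSlit) {v : TM E M}
    (hv : v ∈ slit E M) : ContMDiffAt 𝓘(ℝ, E).tangent 𝓘(ℝ, E).tangent ∞
      (fun v : TM E M => (⟨v.proj, X v⟩ : TM E M)) v :=
  ContMDiffOn.contMDiffAt hX (isOpen_slit.mem_nhds hv)

/-- The change of the trace of the Berwald curvature under a projective change. -/
lemma IsProjectiveChange.berwaldTrace_eq (h : IsProjectiveChange S S' P) {v : TM E M}
    (hv : v ∈ slit E M) {Y Z : FieldAlong E M} (hY : Y.SmoothOnSlit) (hZ : Z.SmoothOnSlit) :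
    berwaldTrace (connection S') Y Z v = berwaldTrace (connection S) Y Z v +
      (Module.finrank ℝ E + 1) * fderiv ℝ (fderiv ℝ (factor P v.proj)) v.2 (Z v) (Y v) := by
  have hb : ∀ b : TangentSpace 𝓘(ℝ, E) v.proj,
      berwaldCurvature (connection S') (basic (FiberBundle.extend E b)) Y Z v =
      berwaldCurvature (connection S) (basic (FiberBundle.extend E b)) Y Z v +
      berwaldChange P v b (Z v) (Y v) := by
    intro b
    have h1 : ContMDiffAt 𝓘(ℝ, E).tangent 𝓘(ℝ, E).tangent ∞
        (fun v : TM E M => (⟨v.proj, basic (FiberBundle.extend E b) v⟩ : TM E M)) v :=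
      ContMDiffAt.comp v (FiberBundle.contMDiffAt_extend 𝓘(ℝ, E) E b)
        (contMDiff_proj (TangentSpace 𝓘(ℝ, E) : M → Type _)).contMDiffAt
    rw [h.berwaldCurvature_eq hv h1 (hY.contMDiffAt hv) (hZ.contMDiffAt hv)]
    simp only [basic, FiberBundle.extend_apply_self]
  have hsum := sum_coord_fderiv_fderiv_fderiv_smul_self
    (fun y hy => h.contDiffAt_factor v.proj hy) (fun y hy => h.fderiv_factor_self v.proj hy)
    (y := v.2) hv (Z v) (Y v) (Module.finBasis ℝ E)
  unfold berwaldTrace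
  simp only
  rw [← hsum, ← Finset.sum_add_distrib]
  refine Finset.sum_congr rfl fun i _ => ?_
  rw [hb]
  exact map_add _ _ _

lemma IsProjectiveChange.isLiftOfOneForm (h : IsProjectiveChange S S' P)
    (hdim : 2 ≤ Module.finrank ℝ E)
    (h2 : ∀ (p : M) (y : E), y ≠ 0 → fderiv ℝ (fderiv ℝ (factor P p)) y = 0) :
    IsLiftOfOneForm P := by
  choose α hα using fun p : M => eq_fderiv_of_fderiv_fderiv_eq_zero hdim (h.continuous_factor p)
    (fun y hy => h.contDiffAt_factor p hy) (fun y hy => h.fderiv_factor_self p hy) (h2 p)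
  have hP : ∀ v : TM E M, P v = α v.proj v.2 := fun v => hα v.proj v.2
  refine ⟨α, h.isOneForm hP, fun ξ hξ v => ?_⟩
  change P v = α v.proj (proj v (ξ v))
  rw [hξ.proj_eq, hP]

variable [T2Space M]

/-- The condition on `P` quantifies over second-order fields and would say nothing without one;
evaluating on an existing `ξ`, with `𝐣ξ(v) = v`, gives `P(v) = α(v)`. -/
lemma IsLiftOfOneForm.exists_factor_eq [SecondCountableTopology M] (hP : IsLiftOfOneForm P)
    (p : M) : ∃ L : E →L[ℝ] ℝ, factor P p = L := by
  obtain ⟨α, -, hα⟩ := hP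
  obtain ⟨ξ, hξ⟩ := exists_isSecondOrder (E := E) (M := M)
  refine ⟨α p, funext fun y => ?_⟩
  have h1 : P ⟨p, y⟩ = α p (proj ⟨p, y⟩ (ξ ⟨p, y⟩)) := hα ξ hξ ⟨p, y⟩
  rw [hξ.proj_eq] at h1
  exact h1

lemma IsLiftOfOneForm.fderiv_fderiv_factor [SecondCountableTopology M] (hP : IsLiftOfOneForm P)
    (p : M) : fderiv ℝ (fderiv ℝ (factor P p)) = 0 := by
  obtain ⟨L, hL⟩ := hP.exists_factor_eq p
  have h1 : fderiv ℝ (factor P p) = fun _ => L := by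
    rw [hL]
    funext y
    exact L.fderiv
  rw [h1]
  funext y
  simp

lemma IsProjectiveChange.factor₃_eq_zero [SecondCountableTopology M]
    (h : IsProjectiveChange S S' P) (hP : IsLiftOfOneForm P) (p : M) {y : E} (hy : y ≠ 0)
    (a c b : E) : factor₃ P p y a c b = 0 := by
  unfold factor₃
  rw [fderiv_fderiv_fderiv_smul_self (fun y hy => h.contDiffAt_factor p hy) hy,
    hP.fderiv_fderiv_factor p]
  simp

/-- Any three vectors at a point are values of smooth fields, so equal curvatures mean `D³(P y) =
0`; its trace `(n + 1) D²P` then vanishes as well. -/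
theorem IsProjectiveChange.sameBerwaldCurvature_iff [SecondCountableTopology M]
    (h : IsProjectiveChange S S' P) (hdim : 2 ≤ Module.finrank ℝ E) :
    SameBerwaldCurvature S S' ↔ IsLiftOfOneForm P := by
  constructor
  · intro hB
    refine h.isLiftOfOneForm hdim fun p y hy => ?_
    have h0 : ∀ a c b : E, factor₃ P p y a c b = 0 := by
      intro a c b
      obtain ⟨X, rfl, hX⟩ := exists_smoothOnSlit (⟨p, y⟩ : TM E M) a
      obtain ⟨Y, rfl, hY⟩ := exists_smoothOnSlit (⟨p, y⟩ : TM E M) b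
      obtain ⟨Z, rfl, hZ⟩ := exists_smoothOnSlit (⟨p, y⟩ : TM E M) c
      have hv : (⟨p, y⟩ : TM E M) ∈ slit E M := hy
      have h1 := h.berwaldCurvature_eq hv (hX.contMDiffAt hv) (hY.contMDiffAt hv)
        (hZ.contMDiffAt hv)
      rw [hB X Y Z hX hY hZ _ hv] at h1
      exact left_eq_add.1 h1
    ext c b
    have hsum := sum_coord_fderiv_fderiv_fderiv_smul_self
      (fun y hy => h.contDiffAt_factor p hy) (fun y hy => h.fderiv_factor_self p hy)
      hy c b (Module.finBasis ℝ E)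
    have h2 : ∀ i, fderiv ℝ (fderiv ℝ (fderiv ℝ (fun y => factor P p y • y))) y
        (Module.finBasis ℝ E i) c b = 0 := fun i => h0 _ c b
    simp only [h2, map_zero, Finset.sum_const_zero] at hsum
    exact (mul_eq_zero.1 hsum.symm).resolve_left (by positivity)
  · intro hP X Y Z hX hY hZ v hv
    rw [h.berwaldCurvature_eq hv (hX.contMDiffAt hv) (hY.contMDiffAt hv) (hZ.contMDiffAt hv)]
    exact add_eq_left.2 (h.factor₃_eq_zero hP v.proj hv _ _ _)

theorem IsProjectiveChange.isBerwald_iff [SecondCountableTopology M]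
    (h : IsProjectiveChange S S' P) (hdim : 2 ≤ Module.finrank ℝ E) (hS : IsBerwald S) :
    IsBerwald S' ↔ IsLiftOfOneForm P := by
  rw [← h.sameBerwaldCurvature_iff hdim]
  constructor
  · intro hS' X Y Z hX hY hZ v hv
    rw [hS X Y Z hX hY hZ v hv, hS' X Y Z hX hY hZ v hv]
  · intro hB X Y Z hX hY hZ v hv
    rw [hB X Y Z hX hY hZ v hv, hS X Y Z hX hY hZ v hv]

/-- When `S` is traceless, the trace for `S'` is exactly `(n + 1) D²P`, so only this contraction of
`D³(P y)` is needed in either direction. -/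
theorem IsProjectiveChange.isWeaklyBerwald_iff [SecondCountableTopology M]
    (h : IsProjectiveChange S S' P) (hdim : 2 ≤ Module.finrank ℝ E) (hS : IsWeaklyBerwald S) :
    IsWeaklyBerwald S' ↔ IsLiftOfOneForm P := by
  constructor
  · intro hS'
    refine h.isLiftOfOneForm hdim fun p y hy => ?_
    ext c b
    obtain ⟨Y, rfl, hY⟩ := exists_smoothOnSlit (⟨p, y⟩ : TM E M) b
    obtain ⟨Z, rfl, hZ⟩ := exists_smoothOnSlit (⟨p, y⟩ : TM E M) c
    have hv : (⟨p, y⟩ : TM E M) ∈ slit E M := hy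
    have h1 := h.berwaldTrace_eq hv hY hZ
    rw [hS Y Z hY hZ _ hv, hS' Y Z hY hZ _ hv, zero_add] at h1
    exact (mul_eq_zero.1 h1.symm).resolve_left (by positivity)
  · intro hP Y Z hY hZ v hv
    have h0 := congrFun (hP.fderiv_fderiv_factor v.proj) v.2
    rw [h.berwaldTrace_eq hv hY hZ, hS Y Z hY hZ v hv, zero_add]
    exact mul_eq_zero_of_right _ (DFunLike.congr_fun (DFunLike.congr_fun h0 (Z v)) (Y v))

end Change

end

end SprayGeometry

theorem mainTheorem12
    {E : Type*} [NormedAddCommGroup E] [NormedSpace ℝ E] [FiniteDimensional ℝ E]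
    (hdim : 2 ≤ Module.finrank ℝ E)
    {M : Type*} [TopologicalSpace M] [ChartedSpace E M] [IsManifold 𝓘(ℝ, E) ∞ M]
    [T2Space M] [SecondCountableTopology M] [ConnectedSpace M]
    (S S' : SprayGeometry.FieldTM E M) (P : SprayGeometry.TM E M → ℝ)
    (h : SprayGeometry.IsProjectiveChange S S' P) :
    (SprayGeometry.SameBerwaldCurvature S S' ↔ SprayGeometry.IsLiftOfOneForm P) ∧
    (SprayGeometry.IsBerwald S →
      (SprayGeometry.IsBerwald S' ↔ SprayGeometry.IsLiftOfOneForm P)) ∧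
    (SprayGeometry.IsWeaklyBerwald S →
      (SprayGeometry.IsWeaklyBerwald S' ↔ SprayGeometry.IsLiftOfOneForm P)) :=
  ⟨h.sameBerwaldCurvature_iff hdim, h.isBerwald_iff hdim, h.isWeaklyBerwald_iff hdim⟩
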